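/- Let $M$ be a smooth surface, $f:M\to\mathbb E^3$ a smooth immersion ($M$ carries the induced metric) with smooth unit normal field $N$, and let $\vec k\in\mathbb E^3$ be a fixed unit vector. Let $\theta=\angle(N,\vec k)$ be the angle function, let $U$ be the tangent part of $\vec k$, so that $\vec k=U+\cos\theta\,N$, let $A$ be the shape operator, $dN(X)=-AX$, and let $K=\det A$ be the Gaussian curvature. We say that $U$ is a \emph{canonical principal direction} if at every point $U\neq0$ (i.e. $\theta\in(0,\pi)$) and $AU=\lambda U$ with $\lambda\neq0$. Suppose that $U$ is a canonical principal direction. Consider the following two cases for a point $p\in M$: there are local coordinates $(x,y)$ on a neighbourhood of $p$, in which the angle function is a smooth function $\theta=\theta(x)\in(0,\pi)$ with $\theta'\neq 0$ on an open interval $I\ni0$, and a primitive $\phi$ of $\cos\theta$ on $I$, such that, after an isometry of $\mathbb E^3$ whose linear part maps $\vec k$ to $(0,0,1)$, the immersion is Case 1: $$r(x,y)=\Big(\phi(x)(\cos y,\sin y)+\gamma(y),\ \int_0^x\sin\theta(\tau)\,d\tau\Big),\qquad \gamma(y)=\Big(-\int_0^y\psi(\tau)\sin\tau\,d\tau,\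 \int_0^y\psi(\tau)\cos\tau\,d\tau\Big),$$ where $\psi$ is a smooth function on an open interval $J\ni 0$ and $\phi(x)+\psi(y)\ne0$ on the coordinate domain; or Case 2: $$r(x,y)=\Big(\phi(x)\cos y_0,\ \phi(x)\sin y_0,\ \int_0^x\sin\theta(\tau)\,d\tau\Big)+y\,\mathrm v_0,\qquad \mathrm v_0=(-\sin y_0,\cos y_0,0),\ y_0\in\mathbb R$$ (a cylinder). Then Case 1 holds near every point $p$ with $K(p)\neq0$, and Case 2 holds near every point $p$ such that $K=0$ on a neighbourhood of $p$; in particular the points near which the surface is given by one of the two cases form a dense set. Conversely, let $\theta$ be a smooth function with values in $(0,\pi)$ and nowhere vanishing derivative on an open interval $I\ni0$, let $\phi$ be a primitive of $\cos\theta$ on $I$, and let $\psi$ be a smooth function on an open interval $J\ni 0$ (Case 1), or $y_0\in\mathbb R$ (Case 2). If, in global coordinates $(x,y)$ on $M$ (with $x\in I$, and in Case 1 $y\in J$ and $\phi(x)+\psi(y)\neq0$), and up to an isometry of $\mathbb E^3$ whose linear part maps $\vec k$ to $(0,0,1)$, a map $M\to\mathbb E^3$ is given by the formula of Case 1 or of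 Case 2, then it is a smooth immersion, it has a smooth unit normal field whose angle function is $\theta(x)$, and $U$ is a canonical principal direction of it. -/

import Mathlib

open scoped Manifold ContDiff

noncomputable section

namespace CanonicalDirection

/-- The coordinate plane of the parameters `(x, y)`. -/
abbrev E2 : Type := EuclideanSpace ℝ (Fin 2)

/-- Euclidean 3-space. -/
abbrev E3 : Type := EuclideanSpace ℝ (Fin 3)

/-- The vertical unit vector `(0, 0, 1)`. -/
def e3 : E3 := !₂[0, 0, 1]

section Surfaces

variable {M : Type*} [TopologicalSpace M] [ChartedSpace E2 M]

/-- The differential at `p` of a map from a surface `M` to `E3`. -/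
def diff (f : M → E3) (p : M) : TangentSpace (𝓡 2) p →L[ℝ] E3 :=
  mfderiv (𝓡 2) 𝓘(ℝ, E3) f p

/-- `f : M → E3` is a smooth immersion. It is an isometric immersion for the metric that it induces
on `M`. -/
structure IsSmoothImmersion (f : M → E3) : Prop where
  smooth : ContMDiff (𝓡 2) 𝓘(ℝ, E3) ∞ f
  injective : ∀ p, Function.Injective (diff f p)

/-- `N` is a smooth unit normal field along `f`. -/
structure IsUnitNormal (f N : M → E3) : Prop where
  smooth : ContMDiff (𝓡 2) 𝓘(ℝ, E3) ∞ N
  norm_eq_one : ∀ p, ‖N p‖ = 1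
  orthogonal : ∀ p v, inner ℝ (N p) (diff f p v) = 0

/-- For a vector `w` of `E3` that is tangent to the immersed surface at `p`, the vector of `T_p M`
that corresponds to `w` under the differential of the immersion. -/
def toTangent (f : M → E3) (p : M) : E3 →ₗ[ℝ] TangentSpace (𝓡 2) p :=
  (diff f p).toLinearMap.leftInverse

/-- The tangent part `U` of the fixed direction `k`, determined by `k = U + cos θ N`, where
`cos θ = ⟨k, N⟩`. -/
def tangentPart (f N : M → E3) (k : E3) (p : M) : TangentSpace (𝓡 2) p :=
  toTangent f p (k - inner ℝ k (N p) • N p)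

/-- The shape operator `A`, determined by the Weingarten formula `dN(X) = - A X`. -/
def shapeOperator (f N : M → E3) (p : M) :
    TangentSpace (𝓡 2) p →ₗ[ℝ] TangentSpace (𝓡 2) p :=
  -(toTangent f p ∘ₗ (diff N p).toLinearMap)

/-- The Gaussian curvature `K = det A`. -/
def gaussCurvature (f N : M → E3) (p : M) : ℝ :=
  LinearMap.det (shapeOperator f N p)

/-- `U` is a canonical principal direction: at every point it is a principal direction (in
particular nonzero, so that the angle function takes its values in `(0, π)`), and the corresponding
principal curvature is different from zero. -/
def IsCanonicalPrincipal (f N : M → E3) (k : E3) : Prop :=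
  ∀ p, tangentPart f N k p ≠ 0 ∧
    ∃ c : ℝ, c ≠ 0 ∧ shapeOperator f N p (tangentPart f N k p) = c • tangentPart f N k p

theorem mem_range_of_inner_eq_zero {f N : M → E3} (hf : IsSmoothImmersion f)
    (hN : IsUnitNormal f N) {p : M} {w : E3} (hw : inner ℝ (N p) w = 0) :
    ∃ v, diff f p v = w := by
  have h1 : (diff f p).toLinearMap.range ≤ (ℝ ∙ (N p))ᗮ := by
    rintro _ ⟨v, rfl⟩
    exact Submodule.mem_orthogonal_singleton_iff_inner_right.2 (hN.orthogonal p v)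
  have hN0 : N p ≠ 0 := by
    intro h
    have := hN.norm_eq_one p
    simp [h] at this
  have h2 : Module.finrank ℝ (diff f p).toLinearMap.range = 2 := by
    rw [LinearMap.finrank_range_of_inj (hf.injective p)]
    exact finrank_euclideanSpace_fin
  have : Fact (Module.finrank ℝ E3 = 2 + 1) := ⟨finrank_euclideanSpace_fin⟩
  have h3 : Module.finrank ℝ (ℝ ∙ (N p))ᗮ = 2 := Submodule.finrank_orthogonal_span_singleton hN0
  have h4 := Submodule.eq_of_le_of_finrank_eq h1 (h2.trans h3.symm)
  have h5 : w ∈ (diff f p).toLinearMap.range := by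
    rw [h4]
    exact Submodule.mem_orthogonal_singleton_iff_inner_right.2 hw
  exact h5

theorem diff_toTangent {f N : M → E3} (hf : IsSmoothImmersion f)
    (hN : IsUnitNormal f N) {p : M} {w : E3} (hw : inner ℝ (N p) w = 0) :
    diff f p (toTangent f p w) = w := by
  obtain ⟨v, rfl⟩ := mem_range_of_inner_eq_zero hf hN hw
  congr 1
  exact LinearMap.leftInverse_apply_of_inj (LinearMap.ker_eq_bot.2 (hf.injective p)) v

/-- The decomposition `k = U + cos θ N`. -/
theorem diff_tangentPart {f N : M → E3} (hf : IsSmoothImmersion f)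
    (hN : IsUnitNormal f N) (k : E3) (p : M) :
    diff f p (tangentPart f N k p) + inner ℝ k (N p) • N p = k := by
  have h : inner ℝ (N p) (k - inner ℝ k (N p) • N p) = 0 := by
    rw [inner_sub_right, inner_smul_right, real_inner_self_eq_norm_sq, hN.norm_eq_one p,
      real_inner_comm]
    ring
  rw [tangentPart, diff_toTangent hf hN h]
  abel

/-- The Weingarten formula. -/
theorem diff_shapeOperator {f N : M → E3} (hf : IsSmoothImmersion f)
    (hN : IsUnitNormal f N) (p : M) (v : TangentSpace (𝓡 2) p) :
    diff f p (shapeOperator f N p v) = - diff N p v := by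
  have hd : MDifferentiableAt (𝓡 2) 𝓘(ℝ, E3) N p :=
    (hN.smooth p).mdifferentiableAt (by simp)
  have h : inner ℝ (N p) (diff N p v) = 0 := by
    have e1 : HasMFDerivAt (𝓡 2) 𝓘(ℝ, ℝ) (fun q => ‖N q‖ ^ 2) p
        ((2 • (innerSL ℝ (N p))).comp (diff N p)) :=
      HasMFDerivAt.comp p (hasStrictFDerivAt_norm_sq (N p)).hasFDerivAt.hasMFDerivAt
        hd.hasMFDerivAt
    have e2 : (fun q => ‖N q‖ ^ 2) = fun _ => (1 : ℝ) := by
      funext q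
      simp [hN.norm_eq_one q]
    rw [e2] at e1
    have d1 := hasMFDerivAt_unique e1 (hasMFDerivAt_const (1 : ℝ) p)
    have d2 : (2 • innerSL ℝ (N p)) (diff N p v) = (0 : ℝ) := congrArg (fun L => L v) d1
    have d3 : inner ℝ (N p) (diff N p v) + inner ℝ (N p) (diff N p v) = (0 : ℝ) := by
      rw [two_smul] at d2
      exact d2
    linarith
  have h2 := diff_toTangent hf hN h
  simp only [shapeOperator, LinearMap.neg_apply, map_neg]
  exact congrArg Neg.neg h2

end Surfaces

/-- `I` is an open interval that contains `0`. -/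
def IsIntervalAboutZero (I : Set ℝ) : Prop :=
  IsOpen I ∧ I.OrdConnected ∧ (0 : ℝ) ∈ I

/-- `θ` is a smooth function on `I` with values in `(0, π)` and nowhere vanishing derivative, and
`φ` is a primitive of `cos θ` on `I`. -/
structure IsAngleData (I : Set ℝ) (θ φ : ℝ → ℝ) : Prop where
  interval : IsIntervalAboutZero I
  smooth : ContDiffOn ℝ ∞ θ I
  mem_Ioo : ∀ x ∈ I, θ x ∈ Set.Ioo 0 Real.pi
  deriv_ne_zero : ∀ x ∈ I, deriv θ x ≠ 0
  primitive : ∀ x ∈ I, HasDerivAt φ (Real.cos (θ x)) x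

/-- The parametrization of Case 1,
`r(x, y) = (φ(x) (cos y, sin y) + γ(y), ∫_0^x sin θ)` with
`γ(y) = (- ∫_0^y ψ(τ) sin τ dτ, ∫_0^y ψ(τ) cos τ dτ)`. -/
def caseOne (θ φ ψ : ℝ → ℝ) (x y : ℝ) : E3 :=
  !₂[φ x * Real.cos y + -∫ τ in (0 : ℝ)..y, ψ τ * Real.sin τ,
     φ x * Real.sin y + ∫ τ in (0 : ℝ)..y, ψ τ * Real.cos τ,
     ∫ τ in (0 : ℝ)..x, Real.sin (θ τ)]

/-- The parametrization of Case 2,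
`r(x, y) = (φ(x) cos y₀, φ(x) sin y₀, ∫_0^x sin θ) + y v₀` with `v₀ = (- sin y₀, cos y₀, 0)`. -/
def caseTwo (θ φ : ℝ → ℝ) (y₀ : ℝ) (x y : ℝ) : E3 :=
  !₂[φ x * Real.cos y₀, φ x * Real.sin y₀, ∫ τ in (0 : ℝ)..x, Real.sin (θ τ)] +
    y • !₂[-Real.sin y₀, Real.cos y₀, 0]

section Cases

variable {M : Type*} [TopologicalSpace M] [ChartedSpace E2 M]

/-- In the local coordinates `(x, y)` of the chart `e` of `M`, and after an isometry of `E3` that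
turns the fixed direction `k` into the vertical direction, `f` is the surface of Case 1 with
the functions `θ`, `φ` on `I` and `ψ` on `J`. The condition `φ + ψ ≠ 0` says that this
parametrization is regular. -/
structure IsCaseOne (f : M → E3) (k : E3) (e : OpenPartialHomeomorph M E2)
    (θ φ ψ : ℝ → ℝ) (I J : Set ℝ) : Prop where
  chart : e ∈ IsManifold.maximalAtlas (𝓡 2) ∞ M
  target : ∀ z ∈ e.target, z 0 ∈ I ∧ z 1 ∈ J
  angleData : IsAngleData I θ φ
  interval : IsIntervalAboutZero J
  smooth : ContDiffOn ℝ ∞ ψ J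
  regular : ∀ z ∈ e.target, φ (z 0) + ψ (z 1) ≠ 0
  formula : ∃ F : E3 ≃ᵃⁱ[ℝ] E3, F.linearIsometryEquiv k = e3 ∧
    ∀ q ∈ e.source, F (f q) = caseOne θ φ ψ (e q 0) (e q 1)

/-- In the local coordinates `(x, y)` of the chart `e` of `M`, and after an isometry of `E3` that
turns the fixed direction `k` into the vertical direction, `f` is the cylinder of Case 2 with
the functions `θ`, `φ` on `I` and the constant `y₀`. -/
structure IsCaseTwo (f : M → E3) (k : E3) (e : OpenPartialHomeomorph M E2)
    (θ φ : ℝ → ℝ) (y₀ : ℝ) (I : Set ℝ) : Prop where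
  chart : e ∈ IsManifold.maximalAtlas (𝓡 2) ∞ M
  target : ∀ z ∈ e.target, z 0 ∈ I
  angleData : IsAngleData I θ φ
  formula : ∃ F : E3 ≃ᵃⁱ[ℝ] E3, F.linearIsometryEquiv k = e3 ∧
    ∀ q ∈ e.source, F (f q) = caseTwo θ φ y₀ (e q 0) (e q 1)

/-- On the domain of the chart `e`, the angle function of the surface is `θ(x)`. -/
def HasAngle (N : M → E3) (k : E3) (e : OpenPartialHomeomorph M E2) (θ : ℝ → ℝ) : Prop :=
  ∀ q ∈ e.source, InnerProductGeometry.angle (N q) k = θ (e q 0)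

/-- Near `p` the surface is given by Case 1, where `θ` is its angle function. -/
def IsCaseOneNear (f N : M → E3) (k : E3) (p : M) : Prop :=
  ∃ (e : OpenPartialHomeomorph M E2) (θ φ ψ : ℝ → ℝ) (I J : Set ℝ),
    p ∈ e.source ∧ IsCaseOne f k e θ φ ψ I J ∧ HasAngle N k e θ

/-- Near `p` the surface is given by Case 2, where `θ` is its angle function. -/
def IsCaseTwoNear (f N : M → E3) (k : E3) (p : M) : Prop :=
  ∃ (e : OpenPartialHomeomorph M E2) (θ φ : ℝ → ℝ) (y₀ : ℝ) (I : Set ℝ),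
    p ∈ e.source ∧ IsCaseTwo f k e θ φ y₀ I ∧ HasAngle N k e θ

/-- `f` is an immersed surface with a unit normal field whose angle function is `θ(x)`, and `U` is
a canonical principal direction of it, whichever unit normal field is used. -/
def IsCanonicalSurface (f : M → E3) (k : E3) (e : OpenPartialHomeomorph M E2)
    (θ : ℝ → ℝ) : Prop :=
  IsSmoothImmersion f ∧ (∃ N, IsUnitNormal f N ∧ HasAngle N k e θ) ∧
    ∀ N, IsUnitNormal f N → IsCanonicalPrincipal f N k

end Cases

end CanonicalDirection

end

open scoped Manifold ContDiff

noncomputable section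

namespace CanonicalDirection

/-! Rotate so that `k` is vertical and write the unit normal in polar angles, N = (-sin θ cos y,
-sin θ sin y, cos θ). With T = (cos θ cos y, cos θ sin y, sin θ) and S = (-sin y, cos y, 0), the
triple T, S, N is orthonormal, U corresponds to sin θ T, and dN = -dθ T - sin θ dy S. Let t, s be
the parameter vectors that df sends to T, S. That U is principal with nonzero curvature says dy(t) =
0 and dθ(t) ≠ 0; symmetry of the second fundamental form then gives dθ(s) = 0. So A is diagonal in
t, s, with entries dθ(t) ≠ 0 and sin θ dy(s), and K vanishes exactly where dy does. This is
`exists_isAdapted`, carried to the surface by `exists_adapted_chart`.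

The rest is integration. The height of f has differential sin θ on t and 0 on s, so θ is locally a
function of the height, and integrating 1 / sin θ over the height gives x with dx(t) = 1, dx(s) = 0
(`exists_angle_coordinate`). If dy ≠ 0, then (x, y) are coordinates; the horizontal part of f minus
φ(x)(cos y, sin y) is killed by t, hence is a curve in y with velocity proportional to (-sin y, cos
y), and the factor is ψ = 1 / dy(s) - φ (`exists_caseOne`). If dy = 0 nearby, y is constant and a
horizontal component of f is the second coordinate (`exists_caseTwo`). The tool throughout is
`IsBoxChart.exists_eq_comp`. Density follows because an open set on which K is not identically 0
contains a point of Case 1.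

Conversely, both formulas give r_x = T and r_y = ρ S with ρ ≠ 0, where y in T, S, N is replaced by a
function Y independent of x. Hence N_x = -θ' T, so the x-direction, which carries U, is principal
with curvature θ' (`isCanonicalSurface_of_param`). -/

/-! ### Box-shaped charts and functions of one coordinate. -/

/-- `u 0, u 1` are smooth coordinates on the source of `e`, and they range over the open square of
half-side `ε` about `a`. -/
structure IsBoxChart (e : OpenPartialHomeomorph E2 E2) (u : Fin 2 → E2 → ℝ) (a : E2) (ε : ℝ) :
    Prop where
  pos : 0 < ε
  target_eq : e.target = {z | ∀ i, z i ∈ Set.Ioo (a i - ε) (a i + ε)}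
  apply_eq : ∀ z ∈ e.source, ∀ i, e z i = u i z
  smooth : ∀ i, ContDiffOn ℝ ∞ (u i) e.source
  smooth_symm : ContDiffOn ℝ ∞ e.symm e.target

theorem isOpen_box (a : E2) (ε : ℝ) :
    IsOpen {z : E2 | ∀ i, z i ∈ Set.Ioo (a i - ε) (a i + ε)} := by
  rw [Set.ofPred_forall]
  exact isOpen_iInter_of_finite fun i => isOpen_Ioo.preimage (by fun_prop)

theorem convex_box (a : E2) (ε : ℝ) :
    Convex ℝ {z : E2 | ∀ i, z i ∈ Set.Ioo (a i - ε) (a i + ε)} := by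
  intro x hx y hy s t hs ht hst i
  exact convex_Ioo _ _ (hx i) (hy i) hs ht hst

theorem exists_box_subset {a : E2} {O : Set E2} (hO : IsOpen O) (ha : a ∈ O) :
    ∃ ε > 0, {z : E2 | ∀ i, z i ∈ Set.Ioo (a i - ε) (a i + ε)} ⊆ O := by
  have hO' : IsOpen ((WithLp.toLp 2 : (Fin 2 → ℝ) → E2) ⁻¹' O) :=
    hO.preimage (PiLp.continuous_toLp 2 _)
  obtain ⟨ε, hε, h⟩ := Metric.isOpen_iff.1 hO' a.ofLp (by simpa using ha)
  refine ⟨ε, hε, fun z hz => ?_⟩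
  have : z.ofLp ∈ Metric.ball a.ofLp ε := by
    rw [ball_pi _ hε]
    intro i _
    change z i ∈ Metric.ball (a i) ε
    rw [Real.ball_eq_Ioo]
    exact hz i
  simpa using h this

theorem hasFDerivAt_pair {u : Fin 2 → E2 → ℝ} {z : E2} (hu : ∀ i, DifferentiableAt ℝ (u i) z) :
    HasFDerivAt (fun z => (WithLp.toLp 2 fun i => u i z : E2))
      ((EuclideanSpace.equiv (Fin 2) ℝ).symm.toContinuousLinearMap.comp
        (ContinuousLinearMap.pi fun i => fderiv ℝ (u i) z)) z :=
  (EuclideanSpace.equiv (Fin 2) ℝ).symm.toContinuousLinearMap.hasFDerivAt.comp z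
    (hasFDerivAt_pi.2 fun i => (hu i).hasFDerivAt)

theorem contDiffAt_pair {u : Fin 2 → E2 → ℝ} {z : E2} (hu : ∀ i, ContDiffAt ℝ ∞ (u i) z) :
    ContDiffAt ℝ ∞ (fun z => (WithLp.toLp 2 fun i => u i z : E2)) z :=
  (EuclideanSpace.equiv (Fin 2) ℝ).symm.toContinuousLinearMap.contDiff.contDiffAt.comp z
    (contDiffAt_pi.2 hu)

/-- Two functions with independent differentials at a point are coordinates near it. -/
theorem exists_isBoxChart {Ω : Set E2} (hΩ : IsOpen Ω) {u : Fin 2 → E2 → ℝ}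
    (hu : ∀ i, ContDiffOn ℝ ∞ (u i) Ω) {z₀ : E2} (hz₀ : z₀ ∈ Ω)
    (hind : ∀ w, (∀ i, fderiv ℝ (u i) z₀ w = 0) → w = 0) :
    ∃ (e : OpenPartialHomeomorph E2 E2) (ε : ℝ), z₀ ∈ e.source ∧ e.source ⊆ Ω ∧
      IsBoxChart e u (WithLp.toLp 2 fun i => u i z₀) ε := by
  have hat : ∀ z ∈ Ω, ∀ i, ContDiffAt ℝ ∞ (u i) z := fun z hz i =>
    (hu i).contDiffAt (hΩ.mem_nhds hz)
  set Φ : E2 → E2 := fun z => WithLp.toLp 2 fun i => u i z with hΦ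
  have hΦs : ∀ z ∈ Ω, ContDiffAt ℝ ∞ Φ z := fun z hz => contDiffAt_pair (hat z hz)
  have hcont : ContinuousAt (fderiv ℝ Φ) z₀ :=
    ((hΦs z₀ hz₀).fderiv_right (m := 0) (by simp)).continuousAt
  have hker : (fderiv ℝ Φ z₀).ker = ⊥ := by
    rw [LinearMap.ker_eq_bot']
    intro w hw
    refine hind w fun i => ?_
    rw [ContinuousLinearMap.coe_coe,
      (hasFDerivAt_pair fun i => (hat z₀ hz₀ i).differentiableAt (by simp)).fderiv] at hw
    exact congrArg (fun v : E2 => v i) hw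
  let L₀ : E2 ≃L[ℝ] E2 :=
    (LinearEquiv.ofInjectiveEndo _ (LinearMap.ker_eq_bot.1 hker)).toContinuousLinearEquiv
  have hL₀ : (L₀ : E2 →L[ℝ] E2) = fderiv ℝ Φ z₀ := by
    ext w : 1
    rfl
  -- Invertible operators form an open set. Invertibility of the differential is needed on a
  -- neighbourhood, so that the inverse map is smooth on all of its domain.
  have hev : ∀ᶠ z in nhds z₀, fderiv ℝ Φ z ∈ Set.range ((↑) : (E2 ≃L[ℝ] E2) → E2 →L[ℝ] E2) :=
    hcont (ContinuousLinearEquiv.isOpen.mem_nhds ⟨L₀, hL₀⟩)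
  obtain ⟨O, hO, hOo, hz₀O⟩ := eventually_nhds_iff.1 hev
  have hd₀ : HasFDerivAt Φ (L₀ : E2 →L[ℝ] E2) z₀ := by
    rw [hL₀]
    exact ((hΦs z₀ hz₀).differentiableAt (by simp)).hasFDerivAt
  let e₀ := (hΦs z₀ hz₀).toOpenPartialHomeomorph Φ hd₀ (by simp)
  have he₀ : ∀ z, e₀ z = Φ z := fun z => rfl
  have hz₀e : z₀ ∈ e₀.source := (hΦs z₀ hz₀).mem_toOpenPartialHomeomorph_source hd₀ (by simp)
  let e₁ := e₀.restrOpen (Ω ∩ O) (hΩ.inter hOo)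
  have hz₀e₁ : z₀ ∈ e₁.source := ⟨hz₀e, hz₀, hz₀O⟩
  obtain ⟨ε, hε, hbox⟩ := exists_box_subset e₁.open_target (e₁.map_source hz₀e₁)
  have hb₀ : Φ z₀ ∈ {z : E2 | ∀ i, z i ∈ Set.Ioo (Φ z₀ i - ε) (Φ z₀ i + ε)} := by
    intro i
    constructor <;> linarith
  -- Passing through the inverse cuts down the target, so that it becomes exactly a box.
  let e := (e₁.symm.restrOpen _ (isOpen_box (Φ z₀) ε)).symm
  have hsrc : ∀ z ∈ e.source, z ∈ e₁.source := by
    intro z hz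
    have := hz.1
    simpa using this
  refine ⟨e, ε, ?_, fun z hz => (hsrc z hz).2.1, hε, ?_, fun z hz i => rfl, fun i =>
    (hu i).mono fun z hz => (hsrc z hz).2.1, ?_⟩
  · have h := e.map_target (x := Φ z₀) ⟨hbox hb₀, hb₀⟩
    have h' : e.symm (Φ z₀) = z₀ := e₁.left_inv hz₀e₁
    rwa [h'] at h
  · exact Set.inter_eq_right.2 hbox
  · intro y hy
    have hy₁ : e.symm y ∈ e₁.source := hsrc _ (e.map_target hy)
    obtain ⟨L, hL⟩ := hO _ hy₁.2.2
    refine ContDiffAt.contDiffWithinAt (e.contDiffAt_symm hy (f₀' := L) ?_ (hΦs _ hy₁.2.1))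
    rw [hL]
    exact ((hΦs _ hy₁.2.1).differentiableAt (by simp)).hasFDerivAt

namespace IsBoxChart

variable {e : OpenPartialHomeomorph E2 E2} {u : Fin 2 → E2 → ℝ} {a : E2} {ε : ℝ}

theorem differentiableAt (h : IsBoxChart e u a ε) {z : E2} (hz : z ∈ e.source) (i : Fin 2) :
    DifferentiableAt ℝ (u i) z :=
  ((h.smooth i).contDiffAt (e.open_source.mem_nhds hz)).differentiableAt (by simp)

theorem mem_Ioo (h : IsBoxChart e u a ε) {z : E2} (hz : z ∈ e.source) (i : Fin 2) :
    u i z ∈ Set.Ioo (a i - ε) (a i + ε) := by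
  have := e.map_source hz
  rw [h.target_eq] at this
  rw [← h.apply_eq z hz i]
  exact this i

theorem differentiableAt_symm (h : IsBoxChart e u a ε) {y : E2} (hy : y ∈ e.target) :
    DifferentiableAt ℝ e.symm y :=
  (h.smooth_symm.contDiffAt (e.open_target.mem_nhds hy)).differentiableAt (by simp)

theorem fderiv_comp_symm (h : IsBoxChart e u a ε) {y : E2} (hy : y ∈ e.target) (i : Fin 2)
    (w : E2) : fderiv ℝ (u i) (e.symm y) (fderiv ℝ e.symm y w) = w i := by
  have h1 : HasFDerivAt (fun y => u i (e.symm y))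
      ((fderiv ℝ (u i) (e.symm y)).comp (fderiv ℝ e.symm y)) y :=
    (h.differentiableAt (e.map_target hy) i).hasFDerivAt.comp y
      (h.differentiableAt_symm hy).hasFDerivAt
  have h2 : HasFDerivAt (fun y : E2 => y i) (EuclideanSpace.proj i : E2 →L[ℝ] ℝ) y :=
    (EuclideanSpace.proj i : E2 →L[ℝ] ℝ).hasFDerivAt
  have h3 : (fun y => u i (e.symm y)) =ᶠ[nhds y] fun y => y i := by
    filter_upwards [e.open_target.mem_nhds hy] with x hx
    rw [← h.apply_eq _ (e.map_target hx) i, e.right_inv hx]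
  exact congrArg (fun L : E2 →L[ℝ] ℝ => L w) (h1.unique (h2.congr_of_eventuallyEq h3))

/-- Differentiating `e.symm ∘ e = id` expresses `w` through the differentials of the coordinates. -/
theorem eq_zero_of_fderiv (h : IsBoxChart e u a ε) {z : E2} (hz : z ∈ e.source) {w : E2}
    (hw : ∀ i, fderiv ℝ (u i) z w = 0) : w = 0 := by
  have h1 := hasFDerivAt_pair fun i => h.differentiableAt hz i
  have hy := e.map_source hz
  have hez : (WithLp.toLp 2 fun i => u i z : E2) = e z := by
    ext i
    exact (h.apply_eq z hz i).symm
  have h2 : HasFDerivAt e.symm (fderiv ℝ e.symm (e z)) (WithLp.toLp 2 fun i => u i z : E2) := by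
    rw [hez]
    exact (h.differentiableAt_symm hy).hasFDerivAt
  have h3 := h2.comp z h1
  have h4 : (fun z => e.symm (WithLp.toLp 2 fun i => u i z : E2)) =ᶠ[nhds z] id := by
    filter_upwards [e.open_source.mem_nhds hz] with x hx
    have : (WithLp.toLp 2 fun i => u i x : E2) = e x := by
      ext i
      exact (h.apply_eq x hx i).symm
    rw [this, e.left_inv hx, id]
  have h5 := (h3.congr_of_eventuallyEq h4.symm).unique (hasFDerivAt_id z)
  have h6 := congrArg (fun L : E2 →L[ℝ] E2 => L w) h5
  have h7 : ((EuclideanSpace.equiv (Fin 2) ℝ).symm.toContinuousLinearMap.comp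
        (ContinuousLinearMap.pi fun i => fderiv ℝ (u i) z)) w = 0 := by
    ext i
    exact hw i
  simp only [ContinuousLinearMap.comp_apply (fderiv ℝ e.symm (e z)), h7, map_zero] at h6
  exact h6.symm

/-- A function whose differential is a multiple of that of one coordinate is a function of that
coordinate. -/
theorem exists_eq_comp (h : IsBoxChart e u a ε) (i : Fin 2) {g : E2 → ℝ}
    (hg : ContDiffOn ℝ ∞ g e.source)
    (hd : ∀ z ∈ e.source, ∀ w, fderiv ℝ (u i) z w = 0 → fderiv ℝ g z w = 0) :
    ∃ G : ℝ → ℝ, ContDiffOn ℝ ∞ G (Set.Ioo (a i - ε) (a i + ε)) ∧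
      ∀ z ∈ e.source, g z = G (u i z) := by
  have hε := h.pos
  -- The coordinate line through the centre of the box; `G` is `g` read along it.
  let σ : ℝ → E2 := fun s => a + (s - a i) • EuclideanSpace.single i 1
  have hσ : ∀ s ∈ Set.Ioo (a i - ε) (a i + ε), σ s ∈ e.target := by
    intro s hs
    rw [h.target_eq]
    intro j
    by_cases hj : j = i
    · subst hj
      simpa [σ] using hs
    · simp [σ, hj, hε]
  have hσi : ∀ s, σ s i = s := by
    intro s
    simp [σ]
  refine ⟨fun s => g (e.symm (σ s)), ?_, ?_⟩
  · have h1 : ContDiff ℝ ∞ σ := by fun_prop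
    exact hg.comp (h.smooth_symm.comp h1.contDiffOn hσ) fun s hs => e.map_target (hσ s hs)
  · intro z hz
    set b := σ (u i z) with hb
    have hbt : b ∈ e.target := hσ _ (h.mem_Ioo hz i)
    have hzt := e.map_source hz
    -- This segment stays in the convex box, and coordinate `i` is constant on it, so `g` has zero
    -- derivative along it.
    let c : ℝ → E2 := AffineMap.lineMap (e z) b
    have hc : ∀ t ∈ Set.Icc (0 : ℝ) 1, c t ∈ e.target := by
      intro t ht
      have hconv : Convex ℝ e.target := by
        rw [h.target_eq]
        exact convex_box a ε
      exact hconv.lineMap_mem hzt hbt ht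
    have hder : ∀ t ∈ Set.Icc (0 : ℝ) 1, HasDerivAt (fun t => g (e.symm (c t))) 0 t := by
      intro t ht
      have hs := e.map_target (hc t ht)
      have hgd := ((hg.contDiffAt (e.open_source.mem_nhds hs)).differentiableAt
        (by simp)).hasFDerivAt
      have h1 := (hgd.comp _ (h.differentiableAt_symm (hc t ht)).hasFDerivAt).comp_hasDerivAt t
        (AffineMap.hasDerivAt_lineMap (a := e z) (b := b))
      refine h1.congr_deriv (hd _ hs _ ?_)
      change fderiv ℝ (u i) (e.symm (c t)) (fderiv ℝ e.symm (c t) (b - e z)) = 0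
      rw [h.fderiv_comp_symm (hc t ht), PiLp.sub_apply, h.apply_eq z hz, hb, hσi, sub_self]
    have hconst := constant_of_has_deriv_right_zero (f := fun t => g (e.symm (c t)))
      (fun t ht => (hder t ht).continuousAt.continuousWithinAt)
      (fun t ht => (hder t ⟨ht.1, ht.2.le⟩).hasDerivWithinAt) 1 (by simp)
    simpa [c, e.left_inv hz] using hconst.symm

theorem eq_of_fderiv_eq_zero (h : IsBoxChart e u a ε) {g : E2 → ℝ}
    (hg : ContDiffOn ℝ ∞ g e.source) (hd : ∀ z ∈ e.source, ∀ w, fderiv ℝ g z w = 0)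
    {z z' : E2} (hz : z ∈ e.source) (hz' : z' ∈ e.source) : g z = g z' := by
  have hpre : IsPreconnected e.source := by
    rw [← e.symm_image_target_eq_source]
    refine IsPreconnected.image ?_ _ e.continuousOn_symm
    rw [h.target_eq]
    exact (convex_box a ε).isPreconnected
  exact e.open_source.is_const_of_fderiv_eq_zero hpre (hg.differentiableOn (by simp))
    (fun x hx => ContinuousLinearMap.ext (hd x hx)) hz hz'

end IsBoxChart

theorem fderiv_coord_apply {g : E2 → E3} {z : E2} (hg : DifferentiableAt ℝ g z) (i : Fin 3)
    (w : E2) : fderiv ℝ (fun z => g z i) z w = fderiv ℝ g z w i := by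
  have h1 : HasFDerivAt (fun z => g z i)
      ((EuclideanSpace.proj i : E3 →L[ℝ] ℝ).comp (fderiv ℝ g z)) z :=
    (EuclideanSpace.proj i : E3 →L[ℝ] ℝ).hasFDerivAt.comp z hg.hasFDerivAt
  rw [h1.fderiv]
  rfl

theorem hasDerivAt_integral_of_continuousOn {g : ℝ → ℝ} {I : Set ℝ} (hI : IsOpen I)
    (hI' : I.OrdConnected) (hg : ContinuousOn g I) {c x : ℝ} (hc : c ∈ I) (hx : x ∈ I) :
    HasDerivAt (fun s => ∫ τ in c..s, g τ) (g x) x :=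
  intervalIntegral.integral_hasDerivAt_right (hg.mono (hI'.uIcc_subset hc hx)).intervalIntegrable
    (hg.stronglyMeasurableAtFilter hI x hx) (hg.continuousAt (hI.mem_nhds hx))

theorem contDiffOn_of_hasDerivAt {g G : ℝ → ℝ} {I : Set ℝ} (hI : IsOpen I)
    (hg : ContDiffOn ℝ ∞ g I) (hG : ∀ x ∈ I, HasDerivAt G (g x) x) : ContDiffOn ℝ ∞ G I :=
  (contDiffOn_infty_iff_deriv_of_isOpen hI).2
    ⟨fun x hx => (hG x hx).differentiableAt.differentiableWithinAt,
      hg.congr fun x hx => (hG x hx).deriv⟩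

theorem IsBoxChart.exists_apply_eq {e : OpenPartialHomeomorph E2 E2} {u : Fin 2 → E2 → ℝ}
    {a : E2} {ε : ℝ} (h : IsBoxChart e u a ε) (i : Fin 2) {x : ℝ}
    (hx : x ∈ Set.Ioo (a i - ε) (a i + ε)) : ∃ z ∈ e.source, u i z = x := by
  have hε := h.pos
  let y : E2 := a + (x - a i) • EuclideanSpace.single i 1
  have hy : y ∈ e.target := by
    rw [h.target_eq]
    intro j
    by_cases hj : j = i
    · subst hj
      simpa [y] using hx
    · simp [y, hj, hε]
  refine ⟨e.symm y, e.map_target hy, ?_⟩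
  rw [← h.apply_eq _ (e.map_target hy), e.right_inv hy]
  simp [y]

/-! ### Integration of the surface from an adapted frame. -/

/-- The surface `f` has the unit normal `(-sin θ cos y, -sin θ sin y, cos θ)` over `Ω`, in terms of
an adapted frame `t`, `s` in which the tangent part of the vertical direction, a multiple of `t`,
is principal with nonzero curvature. -/
structure IsAdapted (Ω : Set E2) (f : E2 → E3) (θ y : E2 → ℝ) (t s : E2 → E2) : Prop where
  isOpen : IsOpen Ω
  smooth : ContDiffOn ℝ ∞ f Ω
  smooth_angle : ContDiffOn ℝ ∞ θ Ω
  smooth_arg : ContDiffOn ℝ ∞ y Ω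
  mem_Ioo : ∀ z ∈ Ω, θ z ∈ Set.Ioo 0 Real.pi
  fderiv_fst : ∀ z ∈ Ω, fderiv ℝ f z (t z) =
    !₂[Real.cos (θ z) * Real.cos (y z), Real.cos (θ z) * Real.sin (y z), Real.sin (θ z)]
  fderiv_snd : ∀ z ∈ Ω, fderiv ℝ f z (s z) = !₂[-Real.sin (y z), Real.cos (y z), 0]
  angle_fst : ∀ z ∈ Ω, fderiv ℝ θ z (t z) ≠ 0
  angle_snd : ∀ z ∈ Ω, fderiv ℝ θ z (s z) = 0
  arg_fst : ∀ z ∈ Ω, fderiv ℝ y z (t z) = 0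
  span : ∀ z ∈ Ω, ∀ w, ∃ a b : ℝ, w = a • t z + b • s z

namespace IsAdapted

variable {Ω : Set E2} {f : E2 → E3} {θ y : E2 → ℝ} {t s : E2 → E2}

theorem mono (h : IsAdapted Ω f θ y t s) {Ω' : Set E2} (ho : IsOpen Ω') (hs : Ω' ⊆ Ω) :
    IsAdapted Ω' f θ y t s where
  isOpen := ho
  smooth := h.smooth.mono hs
  smooth_angle := h.smooth_angle.mono hs
  smooth_arg := h.smooth_arg.mono hs
  mem_Ioo z hz := h.mem_Ioo z (hs hz)
  fderiv_fst z hz := h.fderiv_fst z (hs hz)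
  fderiv_snd z hz := h.fderiv_snd z (hs hz)
  angle_fst z hz := h.angle_fst z (hs hz)
  angle_snd z hz := h.angle_snd z (hs hz)
  arg_fst z hz := h.arg_fst z (hs hz)
  span z hz := h.span z (hs hz)

theorem sin_pos (h : IsAdapted Ω f θ y t s) {z : E2} (hz : z ∈ Ω) : 0 < Real.sin (θ z) :=
  Real.sin_pos_of_pos_of_lt_pi (h.mem_Ioo z hz).1 (h.mem_Ioo z hz).2

theorem smooth_coord (h : IsAdapted Ω f θ y t s) (i : Fin 3) :
    ContDiffOn ℝ ∞ (fun z => f z i) Ω :=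
  (EuclideanSpace.proj i : E3 →L[ℝ] ℝ).contDiff.comp_contDiffOn h.smooth

theorem differentiableAt (h : IsAdapted Ω f θ y t s) {g : E2 → ℝ} (hg : ContDiffOn ℝ ∞ g Ω)
    {z : E2} (hz : z ∈ Ω) : DifferentiableAt ℝ g z :=
  (hg.contDiffAt (h.isOpen.mem_nhds hz)).differentiableAt (by simp)

theorem fderiv_coord (h : IsAdapted Ω f θ y t s) {z : E2} (hz : z ∈ Ω) (i : Fin 3) (w : E2) :
    fderiv ℝ (fun z => f z i) z w = fderiv ℝ f z w i :=
  fderiv_coord_apply ((h.smooth.contDiffAt (h.isOpen.mem_nhds hz)).differentiableAt (by simp)) i w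

theorem fderiv_eq_zero (h : IsAdapted Ω f θ y t s) {z : E2} (hz : z ∈ Ω) {l : E2 →L[ℝ] ℝ}
    (ht : l (t z) = 0) (hs : l (s z) = 0) (w : E2) : l w = 0 := by
  obtain ⟨a, b, rfl⟩ := h.span z hz w
  simp [ht, hs]

/-- There are coordinates `x`, `v` near a point, where `x` is the arc length along the lines of
curvature tangent to the vertical direction, and the angle is a function of `x`. -/
theorem exists_angle_coordinate (h : IsAdapted Ω f θ y t s) {z₀ : E2} (hz₀ : z₀ ∈ Ω)
    {v : E2 → ℝ} (hv : ContDiffOn ℝ ∞ v Ω) (hv₀ : v z₀ = 0)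
    (hvs : fderiv ℝ v z₀ (s z₀) ≠ 0) :
    ∃ (e : OpenPartialHomeomorph E2 E2) (ε : ℝ) (x : E2 → ℝ) (Θ : ℝ → ℝ),
      IsBoxChart e ![x, v] 0 ε ∧ z₀ ∈ e.source ∧ e.source ⊆ Ω ∧
      IsAngleData (Set.Ioo (-ε) ε) Θ (fun r => ∫ τ in (0 : ℝ)..r, Real.cos (Θ τ)) ∧
      (∀ z ∈ e.source, θ z = Θ (x z)) ∧
      (∀ z ∈ e.source, fderiv ℝ x z (t z) = 1) ∧ (∀ z ∈ e.source, fderiv ℝ x z (s z) = 0) ∧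
      ∀ z ∈ e.source, f z 2 = f z₀ 2 + ∫ τ in (0 : ℝ)..x z, Real.sin (Θ τ) := by
  have ht2 : ∀ z ∈ Ω, fderiv ℝ (fun z => f z 2) z (t z) = Real.sin (θ z) := by
    intro z hz
    rw [h.fderiv_coord hz, h.fderiv_fst z hz]
    simp
  have hs2 : ∀ z ∈ Ω, fderiv ℝ (fun z => f z 2) z (s z) = 0 := by
    intro z hz
    rw [h.fderiv_coord hz, h.fderiv_snd z hz]
    simp
  -- The height and `v` are independent: the height has derivative sin θ > 0 along `t` and 0 along
  -- `s`, while `v` has nonzero derivative along `s`.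
  obtain ⟨e₁, ε₁, hz₁, hsub₁, he₁⟩ := exists_isBoxChart h.isOpen
    (u := ![fun z => f z 2, v]) (fun i => by fin_cases i; exacts [h.smooth_coord 2, hv]) hz₀ (by
      intro w hw
      have hw0 : fderiv ℝ (fun z => f z 2) z₀ w = 0 := hw 0
      have hw1 : fderiv ℝ v z₀ w = 0 := hw 1
      obtain ⟨a, b, rfl⟩ := h.span z₀ hz₀ w
      simp only [map_add, map_smul, ht2 z₀ hz₀, hs2 z₀ hz₀, smul_eq_mul, mul_zero, add_zero,
        mul_eq_zero, (h.sin_pos hz₀).ne', or_false] at hw0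
      simp only [hw0, zero_smul, zero_add, map_smul, smul_eq_mul, mul_eq_zero, hvs,
        or_false] at hw1
      simp [hw0, hw1])
  set a₁ : ℝ := f z₀ 2 with ha₁
  set I₁ : Set ℝ := Set.Ioo (a₁ - ε₁) (a₁ + ε₁) with hI₁
  have hε₁ := he₁.pos
  -- The kernel of the differential of the height is spanned by `s`, which also kills dθ.
  obtain ⟨Θ₁, hΘ₁, hθ₁⟩ := he₁.exists_eq_comp 0 (h.smooth_angle.mono hsub₁) (by
    intro z hz w hw
    have hw0 : fderiv ℝ (fun z => f z 2) z w = 0 := hw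
    obtain ⟨a, b, rfl⟩ := h.span z (hsub₁ hz) w
    simp only [map_add, map_smul, ht2 z (hsub₁ hz), hs2 z (hsub₁ hz), smul_eq_mul, mul_zero,
      add_zero, mul_eq_zero, (h.sin_pos (hsub₁ hz)).ne', or_false] at hw0
    simp [hw0, h.angle_snd z (hsub₁ hz)])
  change ContDiffOn ℝ ∞ Θ₁ I₁ at hΘ₁
  have hθ₁ : ∀ z ∈ e₁.source, θ z = Θ₁ (f z 2) := hθ₁
  have hsin₁ : ∀ r ∈ I₁, Real.sin (Θ₁ r) ≠ 0 := by
    intro r hr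
    obtain ⟨z, hz, hzr⟩ := he₁.exists_apply_eq 0 (x := r) hr
    have hzr : f z 2 = r := hzr
    rw [← hzr, ← hθ₁ z hz]
    exact (h.sin_pos (hsub₁ hz)).ne'
  have hinv : ContDiffOn ℝ ∞ (fun r => (Real.sin (Θ₁ r))⁻¹) I₁ := hΘ₁.sin.inv hsin₁
  -- Arc length as a function of height, since height grows at rate sin θ along `t`.
  let X : ℝ → ℝ := fun r => ∫ τ in a₁..r, (Real.sin (Θ₁ τ))⁻¹
  have hX : ∀ r ∈ I₁, HasDerivAt X (Real.sin (Θ₁ r))⁻¹ r := fun r hr =>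
    hasDerivAt_integral_of_continuousOn isOpen_Ioo Set.ordConnected_Ioo hinv.continuousOn
      ⟨by linarith, by linarith⟩ hr
  have hXs : ContDiffOn ℝ ∞ X I₁ := contDiffOn_of_hasDerivAt isOpen_Ioo hinv hX
  have hmem : ∀ z ∈ e₁.source, f z 2 ∈ I₁ := fun z hz => he₁.mem_Ioo hz 0
  let x : E2 → ℝ := fun z => X (f z 2)
  have hx : ContDiffOn ℝ ∞ x e₁.source := hXs.comp ((h.smooth_coord 2).mono hsub₁) hmem
  have hdx : ∀ z ∈ e₁.source, ∀ w, fderiv ℝ x z w =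
      (Real.sin (θ z))⁻¹ * fderiv ℝ (fun z => f z 2) z w := by
    intro z hz w
    have h1 := (hX _ (hmem z hz)).comp_hasFDerivAt z
      (h.differentiableAt (h.smooth_coord 2) (hsub₁ hz)).hasFDerivAt
    have h2 : HasFDerivAt x _ z := h1
    rw [h2.fderiv, hθ₁ z hz]
    rfl
  have hxt : ∀ z ∈ e₁.source, fderiv ℝ x z (t z) = 1 := by
    intro z hz
    rw [hdx z hz, ht2 z (hsub₁ hz), inv_mul_cancel₀ (h.sin_pos (hsub₁ hz)).ne']
  have hxs : ∀ z ∈ e₁.source, fderiv ℝ x z (s z) = 0 := by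
    intro z hz
    rw [hdx z hz, hs2 z (hsub₁ hz), mul_zero]
  have hx₀ : x z₀ = 0 := by simp [x, X, ha₁]
  have h₁ := h.mono e₁.open_source hsub₁
  obtain ⟨e, ε, hz₀e, hsub, he⟩ := exists_isBoxChart e₁.open_source
    (u := ![x, v]) (fun i => by fin_cases i; exacts [hx, hv.mono hsub₁]) hz₁ (by
      intro w hw
      have hw0 : fderiv ℝ x z₀ w = 0 := hw 0
      have hw1 : fderiv ℝ v z₀ w = 0 := hw 1
      obtain ⟨a, b, rfl⟩ := h.span z₀ hz₀ w
      simp only [map_add, map_smul, hxt z₀ hz₁, hxs z₀ hz₁, smul_eq_mul, mul_zero, add_zero,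
        mul_one] at hw0
      simp only [hw0, zero_smul, zero_add, map_smul, smul_eq_mul, mul_eq_zero, hvs,
        or_false] at hw1
      simp [hw0, hw1])
  have hcenter : (WithLp.toLp 2 fun i => (![x, v] : Fin 2 → E2 → ℝ) i z₀ : E2) = 0 := by
    ext i
    fin_cases i
    · exact hx₀
    · exact hv₀
  rw [hcenter] at he
  have hε := he.pos
  have hIoo : Set.Ioo ((0 : E2) 0 - ε) ((0 : E2) 0 + ε) = Set.Ioo (-ε) ε := by simp
  have h₂ := h₁.mono e.open_source hsub
  have hxe : ContDiffOn ℝ ∞ x e.source := hx.mono hsub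
  obtain ⟨Θ, hΘ, hθ⟩ := he.exists_eq_comp 0 h₂.smooth_angle (by
    intro z hz w hw
    have hw0 : fderiv ℝ x z w = 0 := hw
    obtain ⟨a, b, rfl⟩ := h₂.span z hz w
    simp only [map_add, map_smul, hxt z (hsub hz), hxs z (hsub hz), smul_eq_mul, mul_zero,
      add_zero, mul_one] at hw0
    simp [hw0, h₂.angle_snd z hz])
  rw [hIoo] at hΘ
  have hθ : ∀ z ∈ e.source, θ z = Θ (x z) := hθ
  have hxmem : ∀ z ∈ e.source, x z ∈ Set.Ioo (-ε) ε := by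
    intro z hz
    rw [← hIoo]
    exact he.mem_Ioo hz 0
  have hxsurj : ∀ r ∈ Set.Ioo (-ε) ε, ∃ z ∈ e.source, x z = r := by
    intro r hr
    rw [← hIoo] at hr
    exact he.exists_apply_eq 0 hr
  have hzero : (0 : ℝ) ∈ Set.Ioo (-ε) ε := by constructor <;> linarith
  have hΘd : ∀ r ∈ Set.Ioo (-ε) ε, DifferentiableAt ℝ Θ r := fun r hr =>
    (hΘ.contDiffAt (isOpen_Ioo.mem_nhds hr)).differentiableAt (by simp)
  refine ⟨e, ε, x, Θ, he, hz₀e, fun z hz => hsub₁ (hsub hz),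
    ⟨⟨isOpen_Ioo, Set.ordConnected_Ioo, hzero⟩, hΘ, ?_, ?_, ?_⟩, hθ, fun z hz => hxt z (hsub hz),
    fun z hz => hxs z (hsub hz), ?_⟩
  · intro r hr
    obtain ⟨z, hz, rfl⟩ := hxsurj r hr
    rw [← hθ z hz]
    exact h₂.mem_Ioo z hz
  -- A zero of the derivative of `Θ` would force dθ = 0, against `angle_fst`.
  · intro r hr hr0
    obtain ⟨z, hz, rfl⟩ := hxsurj r hr
    have h1 := (hΘd _ hr).hasDerivAt.comp_hasFDerivAt z
      (h₂.differentiableAt hxe hz).hasFDerivAt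
    have h2 : HasFDerivAt θ _ z := h1.congr_of_eventuallyEq (by
      filter_upwards [e.open_source.mem_nhds hz] with z' hz' using hθ z' hz')
    refine h₂.angle_fst z hz ?_
    rw [h2.fderiv, hr0]
    simp
  · intro r hr
    exact hasDerivAt_integral_of_continuousOn isOpen_Ioo Set.ordConnected_Ioo
      hΘ.cos.continuousOn hzero hr
  · let H : ℝ → ℝ := fun r => ∫ τ in (0 : ℝ)..r, Real.sin (Θ τ)
    have hH : ∀ r ∈ Set.Ioo (-ε) ε, HasDerivAt H (Real.sin (Θ r)) r := fun r hr =>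
      hasDerivAt_integral_of_continuousOn isOpen_Ioo Set.ordConnected_Ioo
        hΘ.sin.continuousOn hzero hr
    have hHs : ContDiffOn ℝ ∞ (fun z => H (x z)) e.source :=
      (contDiffOn_of_hasDerivAt isOpen_Ioo hΘ.sin hH).comp hxe hxmem
    intro z hz
    have hconst := he.eq_of_fderiv_eq_zero (g := fun z => f z 2 - H (x z))
      ((h₂.smooth_coord 2).sub hHs) (by
        intro z hz
        have h1 := ((h₂.differentiableAt (h₂.smooth_coord 2) hz).hasFDerivAt).sub
          ((hH _ (hxmem z hz)).comp_hasFDerivAt z (h₂.differentiableAt hxe hz).hasFDerivAt)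
        have h2 : HasFDerivAt (fun z => f z 2 - H (x z)) _ z := h1
        rw [h2.fderiv]
        refine h₂.fderiv_eq_zero hz ?_ ?_
        · simp [ht2 z (hsub₁ (hsub hz)), hxt z (hsub hz), hθ z hz]
        · simp [hs2 z (hsub₁ (hsub hz)), hxs z (hsub hz)]) hz hz₀e
    simp only [hx₀] at hconst
    have hH0 : H 0 = 0 := by simp [H]
    rw [hH0] at hconst
    change f z 2 = f z₀ 2 + H (x z)
    linarith

end IsAdapted

namespace IsAdapted

variable {Ω : Set E2} {f : E2 → E3} {θ y : E2 → ℝ} {t s : E2 → E2}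

/-- The nonvanishing of dy makes `y` itself the second coordinate. The translation `c` absorbs the
constants of integration. -/
theorem exists_caseOne (h : IsAdapted Ω f θ y t s) {z₀ : E2} (hz₀ : z₀ ∈ Ω) (hy₀ : y z₀ = 0)
    (hy : fderiv ℝ y z₀ ≠ 0) :
    ∃ (e : OpenPartialHomeomorph E2 E2) (Θ φ ψ : ℝ → ℝ) (I J : Set ℝ) (c : E3),
      z₀ ∈ e.source ∧ e.source ⊆ Ω ∧ ContDiffOn ℝ ∞ e e.source ∧
      ContDiffOn ℝ ∞ e.symm e.target ∧ (∀ z ∈ e.target, z 0 ∈ I ∧ z 1 ∈ J) ∧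
      IsAngleData I Θ φ ∧ IsIntervalAboutZero J ∧ ContDiffOn ℝ ∞ ψ J ∧
      (∀ z ∈ e.target, φ (z 0) + ψ (z 1) ≠ 0) ∧
      (∀ z ∈ e.source, f z + c = caseOne Θ φ ψ (e z 0) (e z 1)) ∧
      ∀ z ∈ e.source, θ z = Θ (e z 0) := by
  have hys : fderiv ℝ y z₀ (s z₀) ≠ 0 := fun hs =>
    hy (ContinuousLinearMap.ext (h.fderiv_eq_zero hz₀ (h.arg_fst z₀ hz₀) hs))
  obtain ⟨e, ε, x, Θ, he, hz₀e, hsub, hΘ, hθ, hxt, hxs, hf2⟩ :=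
    h.exists_angle_coordinate hz₀ h.smooth_arg hy₀ hys
  have h' := h.mono e.open_source hsub
  have hε := he.pos
  set J : Set ℝ := Set.Ioo (-ε) ε with hJ
  have hzero : (0 : ℝ) ∈ J := by constructor <;> linarith
  have hIoo : ∀ i, Set.Ioo ((0 : E2) i - ε) ((0 : E2) i + ε) = J := by simp [hJ]
  have hxmem : ∀ z ∈ e.source, x z ∈ J := fun z hz => hIoo 0 ▸ he.mem_Ioo hz 0
  have hymem : ∀ z ∈ e.source, y z ∈ J := fun z hz => hIoo 1 ▸ he.mem_Ioo hz 1
  have hysurj : ∀ r ∈ J, ∃ z ∈ e.source, y z = r := fun r hr =>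
    he.exists_apply_eq 1 (by rwa [hIoo])
  have hex : ∀ z ∈ e.source, e z 0 = x z := fun z hz => he.apply_eq z hz 0
  have hey : ∀ z ∈ e.source, e z 1 = y z := fun z hz => he.apply_eq z hz 1
  have hxe : ContDiffOn ℝ ∞ x e.source := he.smooth 0
  have hxd : ∀ z ∈ e.source, HasFDerivAt x (fderiv ℝ x z) z := fun z hz =>
    (h'.differentiableAt hxe hz).hasFDerivAt
  have hyd : ∀ z ∈ e.source, HasFDerivAt y (fderiv ℝ y z) z := fun z hz =>
    (h'.differentiableAt h'.smooth_arg hz).hasFDerivAt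
  have hsne : ∀ z ∈ e.source, s z ≠ 0 := by
    intro z hz h0
    have h1 := h'.fderiv_snd z hz
    rw [h0, map_zero] at h1
    have h2 := congrArg (fun w : E3 => w 0) h1
    have h3 := congrArg (fun w : E3 => w 1) h1
    simp at h2 h3
    nlinarith [Real.sin_sq_add_cos_sq (y z)]
  -- If dy(s) vanished, both coordinate differentials would kill the nonzero vector `s`.
  have hys : ∀ z ∈ e.source, fderiv ℝ y z (s z) ≠ 0 := by
    intro z hz h0
    refine hsne z hz (he.eq_zero_of_fderiv hz fun i => ?_)
    fin_cases i
    · exact hxs z hz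
    · exact h0
  set φ : ℝ → ℝ := fun r => ∫ τ in (0 : ℝ)..r, Real.cos (Θ τ) with hφ
  have hφs : ContDiffOn ℝ ∞ φ J :=
    contDiffOn_of_hasDerivAt isOpen_Ioo hΘ.smooth.cos hΘ.primitive
  have hφx : ∀ z ∈ e.source, HasFDerivAt (fun z => φ (x z)) (Real.cos (θ z) • fderiv ℝ x z) z := by
    intro z hz
    rw [hθ z hz]
    exact (hΘ.primitive _ (hxmem z hz)).comp_hasFDerivAt z (hxd z hz)
  have hφxs : ContDiffOn ℝ ∞ (fun z => φ (x z)) e.source := hφs.comp hxe hxmem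
  -- the horizontal components of `f - φ(x) (cos y, sin y, 0)` depend on `y` alone
  have key : ∀ (i : Fin 3) (p p' : ℝ → ℝ), ContDiff ℝ ∞ p → (∀ r, HasDerivAt p (p' r) r) →
      (∀ z ∈ e.source, fderiv ℝ (fun z => f z i) z (t z) = Real.cos (θ z) * p (y z)) →
      (∀ z ∈ e.source, fderiv ℝ (fun z => f z i) z (s z) = p' (y z)) →
      ∃ Γ : ℝ → ℝ, ContDiffOn ℝ ∞ Γ J ∧ (∀ z ∈ e.source, f z i = φ (x z) * p (y z) + Γ (y z)) ∧
        ∀ z ∈ e.source, deriv Γ (y z) =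
          ((fderiv ℝ y z (s z))⁻¹ - φ (x z)) * p' (y z) := by
    intro i p p' hp hpd hit his
    have hgs : ContDiffOn ℝ ∞ (fun z => f z i - φ (x z) * p (y z)) e.source :=
      (h'.smooth_coord i).sub (hφxs.mul (hp.comp_contDiffOn h'.smooth_arg))
    have hgd : ∀ z ∈ e.source, ∀ w, fderiv ℝ (fun z => f z i - φ (x z) * p (y z)) z w =
        fderiv ℝ (fun z => f z i) z w - (φ (x z) * (p' (y z) * fderiv ℝ y z w) +
          p (y z) * (Real.cos (θ z) * fderiv ℝ x z w)) := by
      intro z hz w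
      have h1 := (h'.differentiableAt (h'.smooth_coord i) hz).hasFDerivAt.sub
        ((hφx z hz).mul ((hpd (y z)).comp_hasFDerivAt z (hyd z hz)))
      have h2 : HasFDerivAt (fun z => f z i - φ (x z) * p (y z)) _ z := h1
      rw [h2.fderiv]
      rfl
    have hgt : ∀ z ∈ e.source, fderiv ℝ (fun z => f z i - φ (x z) * p (y z)) z (t z) = 0 := by
      intro z hz
      rw [hgd z hz, hit z hz, hxt z hz, h'.arg_fst z hz]
      ring
    obtain ⟨Γ, hΓ, hgΓ⟩ := he.exists_eq_comp 1 hgs (by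
      intro z hz w hw
      have hw1 : fderiv ℝ y z w = 0 := hw
      obtain ⟨a, b, rfl⟩ := h'.span z hz w
      simp only [map_add, map_smul, h'.arg_fst z hz, smul_eq_mul, mul_zero, zero_add,
        mul_eq_zero, hys z hz, or_false] at hw1
      simp [hw1, hgt z hz])
    rw [hIoo] at hΓ
    have hgΓ : ∀ z ∈ e.source, f z i - φ (x z) * p (y z) = Γ (y z) := hgΓ
    refine ⟨Γ, hΓ, fun z hz => by linarith [hgΓ z hz], fun z hz => ?_⟩
    have hΓd : HasDerivAt Γ (deriv Γ (y z)) (y z) :=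
      ((hΓ.contDiffAt (isOpen_Ioo.mem_nhds (hymem z hz))).differentiableAt
        (by simp)).hasDerivAt
    have h1 : HasFDerivAt (fun z => f z i - φ (x z) * p (y z)) _ z :=
      (hΓd.comp_hasFDerivAt z (hyd z hz)).congr_of_eventuallyEq (by
        filter_upwards [e.open_source.mem_nhds hz] with z' hz' using hgΓ z' hz')
    have h2 := hgd z hz (s z)
    rw [h1.fderiv, his z hz, hxs z hz] at h2
    have h3 : deriv Γ (y z) * fderiv ℝ y z (s z) =
        p' (y z) - (φ (x z) * (p' (y z) * fderiv ℝ y z (s z)) +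
          p (y z) * (Real.cos (θ z) * 0)) := h2
    have := hys z hz
    field_simp
    linarith
  obtain ⟨Γ₀, hΓ₀, hf0, hΓ₀d⟩ := key 0 Real.cos (fun r => -Real.sin r) Real.contDiff_cos
    Real.hasDerivAt_cos
    (fun z hz => by rw [h'.fderiv_coord hz, h'.fderiv_fst z hz]; simp)
    (fun z hz => by rw [h'.fderiv_coord hz, h'.fderiv_snd z hz]; simp)
  obtain ⟨Γ₁, hΓ₁, hf1, hΓ₁d⟩ := key 1 Real.sin Real.cos Real.contDiff_sin
    Real.hasDerivAt_sin
    (fun z hz => by rw [h'.fderiv_coord hz, h'.fderiv_fst z hz]; simp)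
    (fun z hz => by rw [h'.fderiv_coord hz, h'.fderiv_snd z hz]; simp)
  -- The velocity (Γ₀', Γ₁') is a multiple of the unit vector (-sin, cos); `ψ` is the factor.
  -- Defined this way it is visibly a smooth function of `y` alone.
  let ψ : ℝ → ℝ := fun r => -Real.sin r * deriv Γ₀ r + Real.cos r * deriv Γ₁ r
  have hderiv : ∀ Γ : ℝ → ℝ, ContDiffOn ℝ ∞ Γ J → ContDiffOn ℝ ∞ (deriv Γ) J := fun Γ hΓ =>
    ((contDiffOn_infty_iff_deriv_of_isOpen isOpen_Ioo).1 hΓ).2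
  have hψ : ContDiffOn ℝ ∞ ψ J :=
    (Real.contDiff_sin.neg.contDiffOn.mul (hderiv Γ₀ hΓ₀)).add
      (Real.contDiff_cos.contDiffOn.mul (hderiv Γ₁ hΓ₁))
  have hψy : ∀ z ∈ e.source, ψ (y z) = (fderiv ℝ y z (s z))⁻¹ - φ (x z) := by
    intro z hz
    simp only [ψ, hΓ₀d z hz, hΓ₁d z hz]
    linear_combination ((fderiv ℝ y z (s z))⁻¹ - φ (x z)) * Real.sin_sq_add_cos_sq (y z)
  have hftc : ∀ (Γ g : ℝ → ℝ), ContDiffOn ℝ ∞ Γ J → ContinuousOn g J →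
      (∀ r ∈ J, deriv Γ r = g r) → ∀ r ∈ J, ∫ τ in (0 : ℝ)..r, g τ = Γ r - Γ 0 := by
    intro Γ g hΓ hg hd r hr
    have hss : Set.uIcc 0 r ⊆ J := Set.ordConnected_Ioo.uIcc_subset hzero hr
    refine intervalIntegral.integral_eq_sub_of_hasDerivAt (fun r' hr' => ?_)
      (hg.mono hss).intervalIntegrable
    rw [← hd r' (hss hr')]
    exact ((hΓ.contDiffAt (isOpen_Ioo.mem_nhds (hss hr'))).differentiableAt
        (by simp)).hasDerivAt
  have hi0 : ∀ r ∈ J, ∫ τ in (0 : ℝ)..r, ψ τ * Real.sin τ = Γ₀ 0 - Γ₀ r := by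
    intro r hr
    have := hftc (fun r => -Γ₀ r) (fun τ => ψ τ * Real.sin τ) hΓ₀.neg
      (hψ.continuousOn.mul Real.continuous_sin.continuousOn) (by
        intro r hr
        obtain ⟨z, hz, rfl⟩ := hysurj r hr
        rw [deriv.fun_neg, hΓ₀d z hz, hψy z hz]
        ring) r hr
    rw [this]
    ring
  have hi1 : ∀ r ∈ J, ∫ τ in (0 : ℝ)..r, ψ τ * Real.cos τ = Γ₁ r - Γ₁ 0 :=
    hftc Γ₁ (fun τ => ψ τ * Real.cos τ) hΓ₁
      (hψ.continuousOn.mul Real.continuous_cos.continuousOn) (by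
        intro r hr
        obtain ⟨z, hz, rfl⟩ := hysurj r hr
        rw [hΓ₁d z hz, hψy z hz])
  refine ⟨e, Θ, φ, ψ, J, J, !₂[-Γ₀ 0, -Γ₁ 0, -f z₀ 2], hz₀e, hsub, ?_, he.smooth_symm, ?_, hΘ,
    ⟨isOpen_Ioo, Set.ordConnected_Ioo, hzero⟩, hψ, ?_, ?_, ?_⟩
  · refine contDiffOn_euclidean.2 fun i => ?_
    exact (he.smooth i).congr fun z hz => he.apply_eq z hz i
  · intro z hz
    rw [he.target_eq] at hz
    exact ⟨hIoo 0 ▸ hz 0, hIoo 1 ▸ hz 1⟩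
  -- Regularity holds because φ + ψ = 1 / dy(s).
  · intro w hw
    have hz := e.map_target hw
    rw [← e.right_inv hw, hex _ hz, hey _ hz, hψy _ hz, add_sub_cancel]
    exact inv_ne_zero (hys _ hz)
  · intro z hz
    rw [hex z hz, hey z hz, caseOne, hi0 _ (hymem z hz), hi1 _ (hymem z hz)]
    ext i
    fin_cases i
    · simp [hf0 z hz]
      ring
    · simp [hf1 z hz]
      ring
    · simp [hf2 z hz]
  · intro z hz
    rw [hθ z hz, hex z hz]

/-- With y = 0, df(s) is the second basis vector, so `f z 1` serves as second coordinate, and `f z 0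
- φ (x z)` is constant since both frame vectors kill it. -/
theorem exists_caseTwo (h : IsAdapted Ω f θ y t s) {z₀ : E2} (hz₀ : z₀ ∈ Ω)
    (hy : ∀ z ∈ Ω, y z = 0) :
    ∃ (e : OpenPartialHomeomorph E2 E2) (Θ φ : ℝ → ℝ) (I : Set ℝ) (c : E3),
      z₀ ∈ e.source ∧ e.source ⊆ Ω ∧ ContDiffOn ℝ ∞ e e.source ∧
      ContDiffOn ℝ ∞ e.symm e.target ∧ (∀ z ∈ e.target, z 0 ∈ I) ∧
      IsAngleData I Θ φ ∧
      (∀ z ∈ e.source, f z + c = caseTwo Θ φ 0 (e z 0) (e z 1)) ∧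
      ∀ z ∈ e.source, θ z = Θ (e z 0) := by
  let v : E2 → ℝ := fun z => f z 1 - f z₀ 1
  have hv : ContDiffOn ℝ ∞ v Ω := (h.smooth_coord 1).sub contDiffOn_const
  have hvs : fderiv ℝ v z₀ (s z₀) ≠ 0 := by
    have : fderiv ℝ v z₀ = fderiv ℝ (fun z => f z 1) z₀ := fderiv_sub_const _
    rw [this, h.fderiv_coord hz₀, h.fderiv_snd z₀ hz₀, hy z₀ hz₀]
    simp
  obtain ⟨e, ε, x, Θ, he, hz₀e, hsub, hΘ, hθ, hxt, hxs, hf2⟩ :=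
    h.exists_angle_coordinate hz₀ hv (sub_self _) hvs
  have h' := h.mono e.open_source hsub
  have hIoo : Set.Ioo ((0 : E2) 0 - ε) ((0 : E2) 0 + ε) = Set.Ioo (-ε) ε := by simp
  have hxmem : ∀ z ∈ e.source, x z ∈ Set.Ioo (-ε) ε := fun z hz => hIoo ▸ he.mem_Ioo hz 0
  have hex : ∀ z ∈ e.source, e z 0 = x z := fun z hz => he.apply_eq z hz 0
  have hev : ∀ z ∈ e.source, e z 1 = v z := fun z hz => he.apply_eq z hz 1
  have hxe : ContDiffOn ℝ ∞ x e.source := he.smooth 0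
  set φ : ℝ → ℝ := fun r => ∫ τ in (0 : ℝ)..r, Real.cos (Θ τ) with hφ
  have hφs : ContDiffOn ℝ ∞ φ (Set.Ioo (-ε) ε) :=
    contDiffOn_of_hasDerivAt isOpen_Ioo hΘ.smooth.cos hΘ.primitive
  have hconst : ∀ z ∈ e.source, f z 0 - φ (x z) = f z₀ 0 - φ (x z₀) := by
    intro z hz
    refine he.eq_of_fderiv_eq_zero (g := fun z => f z 0 - φ (x z))
      ((h'.smooth_coord 0).sub (hφs.comp hxe hxmem)) (fun z hz => ?_) hz hz₀e
    have h1 := ((h'.differentiableAt (h'.smooth_coord 0) hz).hasFDerivAt).sub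
      ((hΘ.primitive _ (hxmem z hz)).comp_hasFDerivAt z (h'.differentiableAt hxe hz).hasFDerivAt)
    have h2 : HasFDerivAt (fun z => f z 0 - φ (x z)) _ z := h1
    rw [h2.fderiv]
    refine h'.fderiv_eq_zero hz ?_ ?_
    · simp [h'.fderiv_coord hz, h'.fderiv_fst z hz, hy z (hsub hz), hxt z hz, hθ z hz]
    · simp [h'.fderiv_coord hz, h'.fderiv_snd z hz, hy z (hsub hz), hxs z hz]
  refine ⟨e, Θ, φ, Set.Ioo (-ε) ε, !₂[φ (x z₀) - f z₀ 0, -f z₀ 1, -f z₀ 2], hz₀e, hsub, ?_,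
    he.smooth_symm, ?_, hΘ, ?_, ?_⟩
  · refine contDiffOn_euclidean.2 fun i => ?_
    exact (he.smooth i).congr fun z hz => he.apply_eq z hz i
  · intro z hz
    rw [he.target_eq] at hz
    exact hIoo ▸ hz 0
  · intro z hz
    rw [hex z hz, hev z hz, caseTwo]
    ext i
    fin_cases i
    · simp
      linarith [hconst z hz]
    · simp [v]
      ring
    · simp [hf2 z hz]
  · intro z hz
    rw [hθ z hz, hex z hz]

end IsAdapted

/-! ### The adapted frame from the polar angles of the normal. -/

theorem exists_apply_eq_of_inner_eq_zero {D : E2 →L[ℝ] E3} (hD : Function.Injective D) {n : E3}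
    (hn : ‖n‖ = 1) (horth : ∀ v, inner ℝ n (D v) = 0) {w : E3} (hw : inner ℝ n w = 0) :
    ∃ v, D v = w := by
  have h1 : D.toLinearMap.range ≤ (ℝ ∙ n)ᗮ := by
    rintro _ ⟨v, rfl⟩
    exact Submodule.mem_orthogonal_singleton_iff_inner_right.2 (horth v)
  have hn0 : n ≠ 0 := by
    rintro rfl
    simp at hn
  have h2 : Module.finrank ℝ D.toLinearMap.range = 2 := by
    rw [LinearMap.finrank_range_of_inj hD]
    exact finrank_euclideanSpace_fin
  have : Fact (Module.finrank ℝ E3 = 2 + 1) := ⟨finrank_euclideanSpace_fin⟩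
  have h3 : Module.finrank ℝ (ℝ ∙ n)ᗮ = 2 := Submodule.finrank_orthogonal_span_singleton hn0
  have h4 := Submodule.eq_of_le_of_finrank_eq h1 (h2.trans h3.symm)
  have h5 : w ∈ D.toLinearMap.range := by
    rw [h4]
    exact Submodule.mem_orthogonal_singleton_iff_inner_right.2 hw
  exact h5

/-- The second fundamental form is symmetric. -/
theorem inner_fderiv_normal_comm {Ω : Set E2} (hΩ : IsOpen Ω) {f N : E2 → E3}
    (hf : ContDiffOn ℝ ∞ f Ω) (hN : ContDiffOn ℝ ∞ N Ω)
    (horth : ∀ z ∈ Ω, ∀ w, inner ℝ (N z) (fderiv ℝ f z w) = 0) {z : E2} (hz : z ∈ Ω) (a b : E2) :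
    inner ℝ (fderiv ℝ N z a) (fderiv ℝ f z b) = inner ℝ (fderiv ℝ N z b) (fderiv ℝ f z a) := by
  have hfz := hf.contDiffAt (hΩ.mem_nhds hz)
  have hNd : HasFDerivAt N (fderiv ℝ N z) z :=
    ((hN.contDiffAt (hΩ.mem_nhds hz)).differentiableAt (by simp)).hasFDerivAt
  have hfd : HasFDerivAt (fderiv ℝ f) (fderiv ℝ (fderiv ℝ f) z) z :=
    ((hfz.fderiv_right (m := 1) (by norm_cast)).differentiableAt (by simp)).hasFDerivAt
  have hsymm : IsSymmSndFDerivAt ℝ f z :=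
    hfz.isSymmSndFDerivAt (by
      rw [minSmoothness_of_isRCLikeNormedField]
      exact WithTop.coe_le_coe.2 le_top)
  -- Differentiate ⟨N, df(b)⟩ = 0 in the direction `a`; the second derivative of `f` is symmetric in
  -- `a` and `b`.
  have key : ∀ a b, inner ℝ (N z) (fderiv ℝ (fderiv ℝ f) z a b) +
      inner ℝ (fderiv ℝ N z a) (fderiv ℝ f z b) = 0 := by
    intro a b
    have h1 := hNd.inner ℝ (hfd.clm_apply (hasFDerivAt_const b z))
    have h2 : (fun x => inner ℝ (N x) (fderiv ℝ f x b)) =ᶠ[nhds z] fun _ => (0 : ℝ) := by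
      filter_upwards [hΩ.mem_nhds hz] with x hx using horth x hx b
    have h3 := h1.unique ((hasFDerivAt_const (0 : ℝ) z).congr_of_eventuallyEq h2)
    have h4 := congrArg (fun L : E2 →L[ℝ] ℝ => L a) h3
    simpa using h4
  have h1 := key a b
  have h2 := key b a
  rw [hsymm.eq a b] at h1
  linarith

/-- On the half-space `N z 0 < 0` the normal is never vertical, and arccos and arctan give smooth
global angles, so no branch choice is needed. -/
theorem exists_polar_angles {Ω : Set E2} {N : E2 → E3}
    (hN : ContDiffOn ℝ ∞ N Ω) (hnorm : ∀ z ∈ Ω, ‖N z‖ = 1) (hneg : ∀ z ∈ Ω, N z 0 < 0) :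
    ∃ θ y : E2 → ℝ, ContDiffOn ℝ ∞ θ Ω ∧ ContDiffOn ℝ ∞ y Ω ∧
      (∀ z ∈ Ω, θ z ∈ Set.Ioo 0 Real.pi) ∧ (∀ z, N z 1 = 0 → y z = 0) ∧
      ∀ z ∈ Ω, N z = !₂[-(Real.sin (θ z) * Real.cos (y z)), -(Real.sin (θ z) * Real.sin (y z)),
        Real.cos (θ z)] := by
  have hcoord : ∀ i, ContDiffOn ℝ ∞ (fun z => N z i) Ω := fun i =>
    (EuclideanSpace.proj i : E3 →L[ℝ] ℝ).contDiff.comp_contDiffOn hN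
  have hsq : ∀ z ∈ Ω, N z 0 ^ 2 + N z 1 ^ 2 + N z 2 ^ 2 = 1 := by
    intro z hz
    have := EuclideanSpace.real_norm_sq_eq (N z)
    rw [hnorm z hz, Fin.sum_univ_three] at this
    linarith
  have hlt : ∀ z ∈ Ω, -1 < N z 2 ∧ N z 2 < 1 := by
    intro z hz
    have h1 := hsq z hz
    have h2 := hneg z hz
    constructor <;> nlinarith [sq_nonneg (N z 1)]
  refine ⟨fun z => Real.arccos (N z 2), fun z => Real.arctan (N z 1 / N z 0), ?_, ?_, ?_, ?_, ?_⟩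
  · intro z hz
    exact ContDiffAt.comp_contDiffWithinAt (g := Real.arccos) z
      (Real.contDiffAt_arccos (hlt z hz).1.ne' (hlt z hz).2.ne) (hcoord 2 z hz)
  · exact Real.contDiff_arctan.comp_contDiffOn
      ((hcoord 1).div (hcoord 0) fun z hz => (hneg z hz).ne)
  · intro z hz
    refine ⟨Real.arccos_pos.2 (hlt z hz).2, ?_⟩
    refine lt_of_le_of_ne (Real.arccos_le_pi _) fun h => ?_
    rw [Real.arccos_eq_pi] at h
    linarith [(hlt z hz).1]
  · intro z hz
    simp [hz]
  · intro z hz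
    have h0 := hneg z hz
    have h1 := hsq z hz
    obtain ⟨r, hr⟩ : ∃ r : ℝ, N z 1 / N z 0 = r := ⟨_, rfl⟩
    have hr1 : N z 1 = r * N z 0 := by rw [← hr, div_mul_cancel₀ _ h0.ne]
    have hpos : 0 < √(1 + r ^ 2) := Real.sqrt_pos.2 (by positivity)
    -- From N₀² + N₁² = N₀²(1 + r²); the negative sign of N₀ decides the root.
    have hsin : Real.sin (Real.arccos (N z 2)) = -N z 0 * √(1 + r ^ 2) := by
      rw [Real.sin_arccos, Real.sqrt_eq_iff_mul_self_eq (by nlinarith [hlt z hz])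
        (by nlinarith)]
      have := Real.sq_sqrt (show 0 ≤ 1 + r ^ 2 by positivity)
      rw [hr1] at h1
      linear_combination -N z 0 ^ 2 * this - h1
    ext i
    fin_cases i
    · simp only [hr, hsin, Real.cos_arctan]
      simp
      field_simp
    · simp only [hr, hsin, Real.sin_arctan]
      simp
      rw [hr1]
      field_simp
    · simp [Real.cos_arccos (hlt z hz).1.le (hlt z hz).2.le]

theorem fderiv_polar {Ω : Set E2} (hΩ : IsOpen Ω) {N : E2 → E3} {θ y : E2 → ℝ}
    (hN : ContDiffOn ℝ ∞ N Ω) (hθ : ContDiffOn ℝ ∞ θ Ω) (hy : ContDiffOn ℝ ∞ y Ω)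
    (hpol : ∀ z ∈ Ω, N z = !₂[-(Real.sin (θ z) * Real.cos (y z)),
      -(Real.sin (θ z) * Real.sin (y z)), Real.cos (θ z)]) {z : E2} (hz : z ∈ Ω) (w : E2) :
    fderiv ℝ N z w = -(fderiv ℝ θ z w • !₂[Real.cos (θ z) * Real.cos (y z),
      Real.cos (θ z) * Real.sin (y z), Real.sin (θ z)]) -
      (Real.sin (θ z) * fderiv ℝ y z w) • !₂[-Real.sin (y z), Real.cos (y z), 0] := by
  have hnhds := hΩ.mem_nhds hz
  have hNd := (hN.contDiffAt hnhds).differentiableAt (by simp)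
  have hθd := ((hθ.contDiffAt hnhds).differentiableAt (by simp)).hasFDerivAt
  have hyd := ((hy.contDiffAt hnhds).differentiableAt (by simp)).hasFDerivAt
  have hev : ∀ i, (fun z => N z i) =ᶠ[nhds z] fun z => (!₂[-(Real.sin (θ z) * Real.cos (y z)),
      -(Real.sin (θ z) * Real.sin (y z)), Real.cos (θ z)] : E3) i := by
    intro i
    filter_upwards [hnhds] with x hx
    rw [hpol x hx]
  ext i
  rw [← fderiv_coord_apply hNd, (hev i).fderiv_eq]
  fin_cases i
  · have h1 : HasFDerivAt (fun z => -(Real.sin (θ z) * Real.cos (y z))) _ z :=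
      (hθd.sin.mul hyd.cos).neg
    simp [h1.fderiv]
    ring
  · have h1 : HasFDerivAt (fun z => -(Real.sin (θ z) * Real.sin (y z))) _ z :=
      (hθd.sin.mul hyd.sin).neg
    simp [h1.fderiv]
    ring
  · have h1 : HasFDerivAt (fun z => Real.cos (θ z)) _ z := hθd.cos
    simp [h1.fderiv]
    ring

/-- Principality of U diagonalises dN on the T-direction, and symmetry of the second fundamental
form then handles the S-direction. -/
theorem exists_isAdapted {Ω : Set E2} (hΩ : IsOpen Ω) {f N : E2 → E3}
    (hf : ContDiffOn ℝ ∞ f Ω) (hN : ContDiffOn ℝ ∞ N Ω)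
    (hinj : ∀ z ∈ Ω, Function.Injective (fderiv ℝ f z)) (hnorm : ∀ z ∈ Ω, ‖N z‖ = 1)
    (horth : ∀ z ∈ Ω, ∀ w, inner ℝ (N z) (fderiv ℝ f z w) = 0)
    (hprin : ∀ z ∈ Ω, ∃ (w : E2) (c : ℝ), c ≠ 0 ∧ fderiv ℝ f z w = e3 - N z 2 • N z ∧
      fderiv ℝ N z w = -(c • (e3 - N z 2 • N z)))
    {z₀ : E2} (hz₀ : z₀ ∈ Ω) (h₀ : N z₀ 0 < 0) (h₁ : N z₀ 1 = 0) :
    ∃ (Ω' : Set E2) (θ y : E2 → ℝ) (t s : E2 → E2), Ω' ⊆ Ω ∧ z₀ ∈ Ω' ∧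
      IsAdapted Ω' f θ y t s ∧ y z₀ = 0 ∧ (∀ z ∈ Ω', N z 2 = Real.cos (θ z)) ∧
      ∀ z ∈ Ω', ∀ w, fderiv ℝ N z w = 0 ↔ fderiv ℝ θ z w = 0 ∧ fderiv ℝ y z w = 0 := by
  have hN0 : ContinuousOn (fun z => N z 0) Ω :=
    (EuclideanSpace.proj 0 : E3 →L[ℝ] ℝ).continuous.comp_continuousOn hN.continuousOn
  set Ω' : Set E2 := Ω ∩ (fun z => N z 0) ⁻¹' Set.Iio 0 with hΩ'def
  have hΩ' : IsOpen Ω' := hN0.isOpen_inter_preimage hΩ isOpen_Iio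
  have hsub : Ω' ⊆ Ω := Set.inter_subset_left
  have hN' := hN.mono hsub
  have hf' := hf.mono hsub
  obtain ⟨θ, y, hθ, hy, hθmem, hy1, hpol⟩ := exists_polar_angles hN'
    (fun z hz => hnorm z (hsub hz)) fun z hz => hz.2
  have hDN : ∀ z ∈ Ω', ∀ w, _ := fun z hz w => fderiv_polar hΩ' hN' hθ hy hpol hz w
  have hsin : ∀ z ∈ Ω', 0 < Real.sin (θ z) := fun z hz =>
    Real.sin_pos_of_pos_of_lt_pi (hθmem z hz).1 (hθmem z hz).2
  have hU : ∀ z ∈ Ω', e3 - N z 2 • N z = Real.sin (θ z) • !₂[Real.cos (θ z) * Real.cos (y z),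
      Real.cos (θ z) * Real.sin (y z), Real.sin (θ z)] := by
    intro z hz
    rw [hpol z hz]
    ext i
    fin_cases i
    · simp [e3]
      ring
    · simp [e3]
      ring
    · simp [e3]
      linear_combination -Real.sin_sq_add_cos_sq (θ z)
  -- Compare coefficients in the frame T, S. It is used both for the principal vector and, with c =
  -- 0, for the kernel of dN.
  have hDN0 : ∀ z ∈ Ω', ∀ (w : E2) (c : ℝ), fderiv ℝ N z w =
      -(c • !₂[Real.cos (θ z) * Real.cos (y z), Real.cos (θ z) * Real.sin (y z),
        Real.sin (θ z)]) → fderiv ℝ θ z w = c ∧ fderiv ℝ y z w = 0 := by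
    intro z hz w c hw
    rw [hDN z hz] at hw
    have hs := hsin z hz
    have e0 := congrArg (fun v : E3 => v 0) hw
    have e1 := congrArg (fun v : E3 => v 1) hw
    have e2 := congrArg (fun v : E3 => v 2) hw
    simp at e0 e1 e2
    have hc : fderiv ℝ θ z w = c := by
      rcases e2 with h | h
      · exact h
      · exact absurd h hs.ne'
    refine ⟨hc, ?_⟩
    rw [hc] at e0 e1
    have h3 : Real.sin (θ z) * fderiv ℝ y z w = 0 := by
      linear_combination Real.sin (y z) * e0 - Real.cos (y z) * e1 -
        Real.sin (θ z) * fderiv ℝ y z w * Real.sin_sq_add_cos_sq (y z)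
    exact (mul_eq_zero.1 h3).resolve_left hs.ne'
  have hframe : ∀ z, ∃ t s : E2, z ∈ Ω' → fderiv ℝ f z t =
      !₂[Real.cos (θ z) * Real.cos (y z), Real.cos (θ z) * Real.sin (y z), Real.sin (θ z)] ∧
      fderiv ℝ f z s = !₂[-Real.sin (y z), Real.cos (y z), 0] ∧ fderiv ℝ θ z t ≠ 0 ∧
      fderiv ℝ y z t = 0 := by
    intro z
    by_cases hz : z ∈ Ω'
    swap
    · exact ⟨0, 0, fun h => absurd h hz⟩
    have hs := hsin z hz
    obtain ⟨w, c, hc, hfw, hNw⟩ := hprin z (hsub hz)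
    obtain ⟨s, hs'⟩ := exists_apply_eq_of_inner_eq_zero (hinj z (hsub hz)) (hnorm z (hsub hz))
      (horth z (hsub hz)) (w := !₂[-Real.sin (y z), Real.cos (y z), 0]) (by
        rw [hpol z hz]
        simp [PiLp.inner_apply, Fin.sum_univ_three]
        ring)
    rw [hU z hz] at hfw hNw
    obtain ⟨hc1, hc2⟩ := hDN0 z hz w (c * Real.sin (θ z)) (by rw [hNw, smul_smul])
    refine ⟨(Real.sin (θ z))⁻¹ • w, s, fun _ => ⟨?_, hs', ?_, ?_⟩⟩
    · rw [map_smul, hfw, smul_smul, inv_mul_cancel₀ hs.ne', one_smul]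
    · rw [map_smul, hc1, smul_eq_mul]
      positivity
    · rw [map_smul, hc2, smul_zero]
  choose t s hts using hframe
  refine ⟨Ω', θ, y, t, s, hsub, ⟨hz₀, h₀⟩, ⟨hΩ', hf', hθ, hy, hθmem, fun z hz => (hts z hz).1,
    fun z hz => (hts z hz).2.1, fun z hz => (hts z hz).2.2.1, ?_, fun z hz => (hts z hz).2.2.2,
    ?_⟩, hy1 _ h₁, ?_, ?_⟩
  · intro z hz
    -- ⟨dN(t), S⟩ = 0 because dy(t) = 0, while ⟨dN(s), T⟩ = -dθ(s).
    have hsymm := inner_fderiv_normal_comm hΩ' hf' hN' (fun z hz => horth z (hsub hz)) hz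
      (t z) (s z)
    obtain ⟨ht, hs, -, hyt⟩ := hts z hz
    rw [ht, hs, hDN z hz, hDN z hz, hyt] at hsymm
    simp [PiLp.inner_apply, Fin.sum_univ_three] at hsymm
    linear_combination hsymm - fderiv ℝ θ z (s z) * Real.sin_sq_add_cos_sq (θ z) -
      fderiv ℝ θ z (s z) * Real.cos (θ z) ^ 2 * Real.sin_sq_add_cos_sq (y z)
  · intro z hz w
    obtain ⟨ht, hs, -, -⟩ := hts z hz
    have ho := horth z (hsub hz) w
    set X := fderiv ℝ f z w with hX
    rw [hpol z hz] at ho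
    simp [PiLp.inner_apply, Fin.sum_univ_three] at ho
    -- The coefficients are the inner products of X = df(w) with T and S; X has no component along
    -- N, and df is injective.
    refine ⟨X 0 * (Real.cos (θ z) * Real.cos (y z)) + X 1 * (Real.cos (θ z) * Real.sin (y z)) +
      X 2 * Real.sin (θ z), -X 0 * Real.sin (y z) + X 1 * Real.cos (y z), hinj z (hsub hz) ?_⟩
    rw [map_add, map_smul, map_smul, ht, hs, ← hX]
    have q1 := Real.sin_sq_add_cos_sq (θ z)
    have q2 := Real.sin_sq_add_cos_sq (y z)
    have ho' : Real.cos (θ z) * X 2 =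
        Real.sin (θ z) * (X 0 * Real.cos (y z) + X 1 * Real.sin (y z)) := by
      linear_combination ho
    ext i
    fin_cases i
    · simp
      linear_combination -X 0 * q2 -
        Real.cos (y z) * (X 0 * Real.cos (y z) + X 1 * Real.sin (y z)) * q1 -
        Real.cos (y z) * Real.sin (θ z) * ho'
    · simp
      linear_combination -X 1 * q2 -
        Real.sin (y z) * (X 0 * Real.cos (y z) + X 1 * Real.sin (y z)) * q1 -
        Real.sin (y z) * Real.sin (θ z) * ho'
    · simp
      linear_combination -X 2 * q1 + Real.cos (θ z) * ho'
  · intro z hz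
    simp [hpol z hz]
  · intro z hz w
    constructor
    · intro h
      exact hDN0 z hz w 0 (by simp [h])
    · rintro ⟨h1, h2⟩
      rw [hDN z hz, h1, h2]
      simp

/-! ### Transfer to the surface: every canonical surface is locally of one of the two forms. -/

section

/-- Extend m / ‖m‖ and k, placed at indices 0 and 2, to an orthonormal basis and take coordinates.
-/
theorem exists_linearIsometryEquiv {k m : E3} (hk : ‖k‖ = 1) (hm : m ≠ 0)
    (hkm : inner ℝ k m = 0) :
    ∃ L : E3 ≃ₗᵢ[ℝ] E3, L k = e3 ∧ L m = ‖m‖ • EuclideanSpace.single 0 1 := by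
  have hm0 : ‖m‖ ≠ 0 := norm_ne_zero_iff.2 hm
  let v : Fin 3 → E3 := ![‖m‖⁻¹ • m, 0, k]
  have hv : Orthonormal ℝ (({0, 2} : Set (Fin 3)).domRestrict v) := by
    constructor
    · rintro ⟨i, hi⟩
      rcases hi with rfl | rfl
      · simp [v, norm_smul, hm0]
      · simpa [v] using hk
    · rintro ⟨i, hi⟩ ⟨j, hj⟩ hij
      have hmk : inner ℝ m k = 0 := by rw [real_inner_comm, hkm]
      rcases hi with rfl | rfl <;> rcases hj with rfl | rfl
      · exact absurd rfl hij
      · simp [v, inner_smul_left, hmk]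
      · simp [v, inner_smul_right, hkm]
      · exact absurd rfl hij
  obtain ⟨b, hb⟩ := hv.exists_orthonormalBasis_extension_of_card_eq
    (by simp)
  refine ⟨b.repr, ?_, ?_⟩
  · have : k = b 2 := (hb 2 (by simp)).symm
    rw [this, b.repr_self]
    ext i
    fin_cases i <;> simp [e3]
  · have h0 : ‖m‖⁻¹ • m = b 0 := (hb 0 (by simp)).symm
    have h1 : m = ‖m‖ • b 0 := by rw [← h0, smul_inv_smul₀ hm0]
    conv_lhs => rw [h1]
    rw [map_smul, b.repr_self]

/-- The isometry `x ↦ L x + c`. -/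
theorem exists_affineIsometryEquiv (L : E3 ≃ₗᵢ[ℝ] E3) (c : E3) :
    ∃ F : E3 ≃ᵃⁱ[ℝ] E3, F.linearIsometryEquiv = L ∧ ∀ x, F x = L x + c :=
  ⟨L.toAffineIsometryEquiv.trans (AffineIsometryEquiv.constVAdd ℝ E3 c), by
    ext x : 1
    rfl, fun x => add_comm c (L x)⟩

variable {M : Type*} [TopologicalSpace M] [ChartedSpace E2 M]

theorem mdifferentiable_of_mem_maximalAtlas {e : OpenPartialHomeomorph M E2}
    (he : e ∈ IsManifold.maximalAtlas (𝓡 2) ∞ M) : e.MDifferentiable (𝓡 2) (𝓡 2) :=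
  ⟨(contMDiffOn_of_mem_maximalAtlas he).mdifferentiableOn (by simp),
    (contMDiffOn_symm_of_mem_maximalAtlas he).mdifferentiableOn (by simp)⟩

/-- The differential of a chart of a surface. -/
def chartDiff {e : OpenPartialHomeomorph M E2} (he : e ∈ IsManifold.maximalAtlas (𝓡 2) ∞ M)
    {q : M} (hq : q ∈ e.source) : TangentSpace (𝓡 2) q ≃L[ℝ] E2 :=
  (mdifferentiable_of_mem_maximalAtlas he).mfderiv hq

theorem diff_eq_fderiv_chartDiff {e : OpenPartialHomeomorph M E2}
    (he : e ∈ IsManifold.maximalAtlas (𝓡 2) ∞ M) {q : M} (hq : q ∈ e.source) {f : M → E3}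
    {g : E2 → E3} (hfg : ∀ q ∈ e.source, f q = g (e q)) (hg : DifferentiableAt ℝ g (e q))
    (v : TangentSpace (𝓡 2) q) : diff f q v = fderiv ℝ g (e q) (chartDiff he hq v) := by
  have h1 : HasMFDerivAt (𝓡 2) (𝓡 2) e q (mfderiv (𝓡 2) (𝓡 2) e q) :=
    ((mdifferentiable_of_mem_maximalAtlas he).mdifferentiableAt hq).hasMFDerivAt
  have h2 := hg.hasFDerivAt.hasMFDerivAt.comp q h1
  have h3 : f =ᶠ[nhds q] g ∘ e := by
    filter_upwards [e.open_source.mem_nhds hq] with x hx using hfg x hx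
  have h4 := (h2.congr_of_eventuallyEq h3).mfderiv
  exact congrArg (fun T => T v) h4

theorem contDiffOn_comp_symm {e : OpenPartialHomeomorph M E2}
    (he : e ∈ IsManifold.maximalAtlas (𝓡 2) ∞ M) {f : M → E3}
    (hf : ContMDiff (𝓡 2) 𝓘(ℝ, E3) ∞ f) : ContDiffOn ℝ ∞ (fun z => f (e.symm z)) e.target :=
  contMDiffOn_iff_contDiffOn.1 (hf.comp_contMDiffOn (contMDiffOn_symm_of_mem_maximalAtlas he))

theorem trans_mem_maximalAtlas [IsManifold (𝓡 2) ∞ M] {e : OpenPartialHomeomorph M E2}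
    (he : e ∈ IsManifold.maximalAtlas (𝓡 2) ∞ M) {e' : OpenPartialHomeomorph E2 E2}
    (h : ContDiffOn ℝ ∞ e' e'.source) (h' : ContDiffOn ℝ ∞ e'.symm e'.target) :
    e.trans e' ∈ IsManifold.maximalAtlas (𝓡 2) ∞ M := by
  refine OpenPartialHomeomorph.mem_maximalAtlas_of_contMDiffOn _ ?_ ?_
  · exact (contMDiffOn_iff_contDiffOn.2 h).comp
      ((contMDiffOn_of_mem_maximalAtlas he).mono fun q hq => hq.1) fun q hq => hq.2
  · exact (contMDiffOn_symm_of_mem_maximalAtlas he).comp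
      ((contMDiffOn_iff_contDiffOn.2 h').mono fun q hq => hq.1) fun q hq => hq.2

/-- Since df is injective, A and dN have the same kernel, and an endomorphism has zero determinant
iff its kernel is nontrivial. -/
theorem gaussCurvature_eq_zero_iff {f N : M → E3} (hf : IsSmoothImmersion f)
    (hN : IsUnitNormal f N) (p : M) :
    gaussCurvature f N p = 0 ↔ ∃ v, v ≠ 0 ∧ diff N p v = 0 := by
  have : FiniteDimensional ℝ (TangentSpace (𝓡 2) p) := inferInstanceAs (FiniteDimensional ℝ E2)
  have hA : ∀ v, shapeOperator f N p v = 0 ↔ diff N p v = 0 := by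
    intro v
    rw [← (hf.injective p).eq_iff, map_zero, diff_shapeOperator hf hN, neg_eq_zero]
  constructor
  · intro h
    obtain ⟨v, hv, hv0⟩ := Submodule.exists_mem_ne_zero_of_ne_bot
      (LinearMap.bot_lt_ker_of_det_eq_zero h).ne'
    exact ⟨v, hv0, (hA v).1 hv⟩
  · rintro ⟨v, hv0, hv⟩
    by_contra h
    refine hv0 ((LinearMap.equivOfDetNeZero (shapeOperator f N p) h).injective ?_)
    rw [map_zero]
    exact (hA v).2 hv

variable [IsManifold (𝓡 2) ∞ M]

theorem exists_adapted_chart {f N : M → E3} {k : E3} (hk : ‖k‖ = 1) (hf : IsSmoothImmersion f)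
    (hN : IsUnitNormal f N) (hcan : IsCanonicalPrincipal f N k) (p : M) :
    ∃ (L : E3 ≃ₗᵢ[ℝ] E3) (Ω : Set E2) (θ y : E2 → ℝ) (t s : E2 → E2), L k = e3 ∧
      Ω ⊆ (chartAt E2 p).target ∧ chartAt E2 p p ∈ Ω ∧
      IsAdapted Ω (fun z => L (f ((chartAt E2 p).symm z))) θ y t s ∧ y (chartAt E2 p p) = 0 ∧
      (∀ z ∈ Ω, InnerProductGeometry.angle (N ((chartAt E2 p).symm z)) k = θ z) ∧
      ∀ z ∈ Ω, gaussCurvature f N ((chartAt E2 p).symm z) = 0 ↔ fderiv ℝ y z = 0 := by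
  set e := chartAt E2 p with he
  have hatlas : e ∈ IsManifold.maximalAtlas (𝓡 2) ∞ M := IsManifold.chart_mem_maximalAtlas p
  have hp : p ∈ e.source := mem_chart_source E2 p
  -- Minus the part of N(p) orthogonal to `k`. It is nonzero because U ≠ 0, and sending it to the
  -- positive first axis puts N(p) in the half-plane N₀ < 0, N₁ = 0, so that y = 0 at p.
  set m : E3 := inner ℝ k (N p) • k - N p with hm
  have hkm : inner ℝ k m = 0 := by
    rw [hm, inner_sub_right, inner_smul_right, real_inner_self_eq_norm_sq, hk]
    ring
  have hm0 : m ≠ 0 := by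
    intro h0
    have h1 : N p = inner ℝ k (N p) • k := (sub_eq_zero.1 h0).symm
    have h2 := hN.norm_eq_one p
    rw [h1, norm_smul, hk, mul_one, Real.norm_eq_abs] at h2
    have h3 : inner ℝ k (N p) * inner ℝ k (N p) = 1 := by
      rw [← abs_mul_abs_self, h2, one_mul]
    refine (hcan p).1 (hf.injective p ?_)
    have h4 := diff_tangentPart hf hN k p
    have h5 : inner ℝ k (N p) • N p = k := by
      conv_lhs => rw [h1]
      rw [inner_smul_right, real_inner_self_eq_norm_sq, hk]
      simp [smul_smul, h3]
    rw [h5] at h4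
    rw [map_zero]
    simpa using h4
  obtain ⟨L, hLk, hLm⟩ := exists_linearIsometryEquiv hk hm0 hkm
  have hLN : ∀ q, inner ℝ k (N q) = L (N q) 2 := by
    intro q
    rw [← L.inner_map_map, hLk]
    simp [e3, PiLp.inner_apply, Fin.sum_univ_three]
  have hLNp : L (N p) = inner ℝ k (N p) • e3 - ‖m‖ • EuclideanSpace.single 0 1 := by
    rw [← hLm, ← hLk, ← map_smul, ← map_sub, hm]
    simp
  have hmpos : 0 < ‖m‖ := norm_pos_iff.2 hm0
  have hat : ∀ g : M → E3, ContMDiff (𝓡 2) 𝓘(ℝ, E3) ∞ g → ∀ z ∈ e.target,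
      DifferentiableAt ℝ (fun z => g (e.symm z)) z := fun g hg z hz =>
    ((contDiffOn_comp_symm hatlas hg).contDiffAt (e.open_target.mem_nhds hz)).differentiableAt
      (by simp)
  have hsm : ∀ g : M → E3, ContMDiff (𝓡 2) 𝓘(ℝ, E3) ∞ g →
      ContDiffOn ℝ ∞ (fun z => L (g (e.symm z))) e.target := fun g hg =>
    L.toContinuousLinearEquiv.contDiff.comp_contDiffOn (contDiffOn_comp_symm hatlas hg)
  have hfd : ∀ g : M → E3, ContMDiff (𝓡 2) 𝓘(ℝ, E3) ∞ g → ∀ (z : E2) (hz : z ∈ e.target)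
      (v : TangentSpace (𝓡 2) (e.symm z)), fderiv ℝ (fun z => L (g (e.symm z))) z
        (chartDiff hatlas (e.map_target hz) v) = L (diff g (e.symm z) v) := by
    intro g hg z hz v
    have hd := hat g hg z hz
    have h1 : HasFDerivAt (fun z => L (g (e.symm z)))
        ((L.toContinuousLinearEquiv : E3 →L[ℝ] E3).comp (fderiv ℝ (fun z => g (e.symm z)) z)) z :=
      (L.toContinuousLinearEquiv : E3 →L[ℝ] E3).hasFDerivAt.comp z hd.hasFDerivAt
    have h2 := diff_eq_fderiv_chartDiff hatlas (e.map_target hz) (f := g)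
      (g := fun z => g (e.symm z)) (fun q hq => by rw [e.left_inv hq])
      (by rw [e.right_inv hz]; exact hd) v
    rw [h1.fderiv, h2, e.right_inv hz]
    rfl
  have hsurj : ∀ (z : E2) (hz : z ∈ e.target) (w : E2), ∃ v : TangentSpace (𝓡 2) (e.symm z),
      w = chartDiff hatlas (e.map_target hz) v := fun z hz w =>
    ⟨(chartDiff hatlas (e.map_target hz)).symm w, by simp⟩
  obtain ⟨Ω, θ, y, t, s, hΩ, hpΩ, had, hy0, hcos, hDN⟩ := exists_isAdapted e.open_target
    (hsm f hf.smooth) (hsm N hN.smooth) (by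
      intro z hz w w' hw
      obtain ⟨v, rfl⟩ := hsurj z hz w
      obtain ⟨v', rfl⟩ := hsurj z hz w'
      rw [hfd f hf.smooth z hz, hfd f hf.smooth z hz] at hw
      rw [hf.injective _ (L.injective hw)]) (by
      intro z hz
      rw [L.norm_map, hN.norm_eq_one]) (by
      intro z hz w
      obtain ⟨v, rfl⟩ := hsurj z hz w
      rw [hfd f hf.smooth z hz, L.inner_map_map, hN.orthogonal]) (by
      intro z hz
      obtain ⟨-, c, hc, hAc⟩ := hcan (e.symm z)
      have h1 := eq_sub_of_add_eq (diff_tangentPart hf hN k (e.symm z))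
      have h2 := diff_shapeOperator hf hN (e.symm z) (tangentPart f N k (e.symm z))
      rw [hAc, map_smul] at h2
      refine ⟨chartDiff hatlas (e.map_target hz) (tangentPart f N k (e.symm z)), c, hc, ?_, ?_⟩
      · rw [hfd f hf.smooth z hz, h1, map_sub, map_smul, hLk, hLN]
      · rw [hfd N hN.smooth z hz, ← neg_eq_iff_eq_neg.2 h2, h1, map_neg, map_smul, map_sub,
          map_smul, hLk, hLN])
    (e.map_source hp)
    (by
      rw [e.left_inv hp, hLNp]
      simpa [e3] using hmpos)
    (by
      rw [e.left_inv hp, hLNp]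
      simp [e3])
  refine ⟨L, Ω, θ, y, t, s, hLk, hΩ, hpΩ, had, hy0, ?_, ?_⟩
  · intro z hz
    rw [InnerProductGeometry.angle, hN.norm_eq_one, hk, real_inner_comm, hLN, hcos z hz, mul_one,
      div_one, Real.arccos_cos (had.mem_Ioo z hz).1.le (had.mem_Ioo z hz).2.le]
  · intro z hz
    rw [gaussCurvature_eq_zero_iff hf hN]
    -- On a t + b s the differentials dθ and dy take the values a dθ(t) and b dy(s), with dθ(t) ≠ 0.
    -- So dN has a kernel iff dy(s) = 0, and then `s` spans it.
    constructor
    · rintro ⟨v, hv0, hv⟩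
      have h1 := hfd N hN.smooth z (hΩ hz) v
      rw [hv, map_zero, hDN z hz] at h1
      obtain ⟨a, b, hab⟩ := had.span z hz (chartDiff hatlas (e.map_target (hΩ hz)) v)
      rw [hab] at h1
      obtain ⟨h2, h3⟩ := h1
      simp only [map_add, map_smul, had.angle_snd z hz, had.arg_fst z hz, smul_eq_mul, mul_zero,
        add_zero, zero_add, mul_eq_zero, had.angle_fst z hz, or_false] at h2 h3
      rcases h3 with h3 | h3
      · rw [h2, h3, zero_smul, zero_smul, zero_add] at hab
        exact absurd ((chartDiff hatlas (e.map_target (hΩ hz))).injective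
          (hab.trans (map_zero _).symm)) hv0
      · exact ContinuousLinearMap.ext (had.fderiv_eq_zero hz (had.arg_fst z hz) h3)
    · intro h0
      obtain ⟨v, hv⟩ := hsurj z (hΩ hz) (s z)
      refine ⟨v, ?_, ?_⟩
      · rintro rfl
        have h1 := had.fderiv_snd z hz
        rw [hv, map_zero, map_zero] at h1
        have h2 := congrArg (fun w : E3 => w 0) h1
        have h3 := congrArg (fun w : E3 => w 1) h1
        simp at h2 h3
        nlinarith [Real.sin_sq_add_cos_sq (y z)]
      · have h1 := (hDN z hz (s z)).2 ⟨had.angle_snd z hz, by rw [h0]; rfl⟩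
        rw [hv, hfd N hN.smooth z (hΩ hz)] at h1
        exact (map_eq_zero_iff L L.injective).1 h1

theorem isCaseOneNear {f N : M → E3} {k : E3} (hk : ‖k‖ = 1) (hf : IsSmoothImmersion f)
    (hN : IsUnitNormal f N) (hcan : IsCanonicalPrincipal f N k) {p : M}
    (hK : gaussCurvature f N p ≠ 0) : IsCaseOneNear f N k p := by
  obtain ⟨L, Ω, θ, y, t, s, hLk, hΩ, hpΩ, had, hy0, hang, hcurv⟩ :=
    exists_adapted_chart hk hf hN hcan p
  have hp : p ∈ (chartAt E2 p).source := mem_chart_source E2 p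
  have hy : fderiv ℝ y (chartAt E2 p p) ≠ 0 := by
    rwa [Ne, ← hcurv _ hpΩ, (chartAt E2 p).left_inv hp]
  obtain ⟨e, Θ, φ, ψ, I, J, c, hpe, heΩ, hes, hes', htar, hdata, hJ, hψ, hreg, hform, hθ⟩ :=
    had.exists_caseOne hpΩ hy0 hy
  obtain ⟨F, hFL, hF⟩ := exists_affineIsometryEquiv L c
  refine ⟨(chartAt E2 p).trans e, Θ, φ, ψ, I, J, ⟨hp, hpe⟩,
    ⟨trans_mem_maximalAtlas (IsManifold.chart_mem_maximalAtlas p) hes hes',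
      fun z hz => htar z hz.1, hdata, hJ, hψ, fun z hz => hreg z hz.1,
      F, by rw [hFL, hLk], fun q hq => ?_⟩, fun q hq => ?_⟩
  · have h1 := hform (chartAt E2 p q) hq.2
    rw [(chartAt E2 p).left_inv hq.1] at h1
    rw [hF, h1]
    rfl
  · have h1 := hang (chartAt E2 p q) (heΩ hq.2)
    rw [(chartAt E2 p).left_inv hq.1] at h1
    rw [h1, hθ (chartAt E2 p q) hq.2]
    rfl

/-- Vanishing of K near p makes y constant on a ball, hence 0, its value at p. The rotation has thus
already normalised the cylinder to y₀ = 0. -/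
theorem isCaseTwoNear {f N : M → E3} {k : E3} (hk : ‖k‖ = 1) (hf : IsSmoothImmersion f)
    (hN : IsUnitNormal f N) (hcan : IsCanonicalPrincipal f N k) {p : M}
    (hK : ∀ᶠ q in nhds p, gaussCurvature f N q = 0) : IsCaseTwoNear f N k p := by
  obtain ⟨L, Ω, θ, y, t, s, hLk, hΩ, hpΩ, had, hy0, hang, hcurv⟩ :=
    exists_adapted_chart hk hf hN hcan p
  have hp : p ∈ (chartAt E2 p).source := mem_chart_source E2 p
  have hev : ∀ᶠ z in nhds (chartAt E2 p p),
      z ∈ Ω ∧ gaussCurvature f N ((chartAt E2 p).symm z) = 0 :=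
    (had.isOpen.eventually_mem hpΩ).and
      (((chartAt E2 p).tendsto_symm hp).eventually hK)
  obtain ⟨ε, hε, hball⟩ := Metric.eventually_nhds_iff_ball.1 hev
  have had' := had.mono Metric.isOpen_ball fun z hz => (hball z hz).1
  have hyz : ∀ z ∈ Metric.ball (chartAt E2 p p) ε, y z = 0 := by
    intro z hz
    rw [← hy0]
    exact Metric.isOpen_ball.is_const_of_fderiv_eq_zero (convex_ball _ _).isPreconnected
      (had'.smooth_arg.differentiableOn (by simp))
      (fun x hx => (hcurv x (hball x hx).1).1 (hball x hx).2) hz (Metric.mem_ball_self hε)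
  obtain ⟨e, Θ, φ, I, c, hpe, heΩ, hes, hes', htar, hdata, hform, hθ⟩ :=
    had'.exists_caseTwo (Metric.mem_ball_self hε) hyz
  obtain ⟨F, hFL, hF⟩ := exists_affineIsometryEquiv L c
  refine ⟨(chartAt E2 p).trans e, Θ, φ, 0, I, ⟨hp, hpe⟩,
    ⟨trans_mem_maximalAtlas (IsManifold.chart_mem_maximalAtlas p) hes hes',
      fun z hz => htar z hz.1, hdata, F, by rw [hFL, hLk], fun q hq => ?_⟩, fun q hq => ?_⟩
  · have h1 := hform (chartAt E2 p q) hq.2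
    rw [(chartAt E2 p).left_inv hq.1] at h1
    rw [hF, h1]
    rfl
  · have h1 := hang (chartAt E2 p q) (hball _ (heΩ hq.2)).1
    rw [(chartAt E2 p).left_inv hq.1] at h1
    rw [h1, hθ (chartAt E2 p q) hq.2]
    rfl

end

/-! ### Converse: the explicit surfaces are canonical. -/

section

section Normal

variable {M : Type*} [TopologicalSpace M] [ChartedSpace E2 M]

theorem IsUnitNormal.eq_or_eq_neg {f N N' : M → E3} (hf : IsSmoothImmersion f)
    (hN : IsUnitNormal f N) (hN' : IsUnitNormal f N') (q : M) : N' q = N q ∨ N' q = -N q := by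
  have h1 : inner ℝ (N q) (N' q - inner ℝ (N q) (N' q) • N q) = 0 := by
    rw [inner_sub_right, inner_smul_right, real_inner_self_eq_norm_sq, hN.norm_eq_one]
    ring
  obtain ⟨v, hv⟩ := mem_range_of_inner_eq_zero hf hN h1
  have h2 : inner ℝ (diff f q v) (diff f q v) = 0 := by
    conv_lhs =>
      arg 2
      rw [hv]
    rw [inner_sub_left, inner_smul_left, hN'.orthogonal, hN.orthogonal]
    simp
  rw [inner_self_eq_zero] at h2
  rw [h2] at hv
  have h3 : N' q = inner ℝ (N q) (N' q) • N q := (sub_eq_zero.1 hv.symm)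
  have h4 := hN'.norm_eq_one q
  rw [h3, norm_smul, hN.norm_eq_one, mul_one, Real.norm_eq_abs] at h4
  rcases (abs_eq zero_le_one).1 h4 with h5 | h5
  · left
    rw [h3, h5, one_smul]
  · right
    rw [h3, h5, neg_smul, one_smul]

/-- The sign relating the two normals is the continuous function ⟨N, N'⟩, hence locally constant, so
the differentials carry the same sign. -/
theorem IsUnitNormal.diff_eq_or_eq_neg {f N N' : M → E3} (hf : IsSmoothImmersion f)
    (hN : IsUnitNormal f N) (hN' : IsUnitNormal f N') (q : M) :
    (N' q = N q ∧ diff N' q = diff N q) ∨ (N' q = -N q ∧ diff N' q = -diff N q) := by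
  have hc : Continuous fun x => inner ℝ (N x) (N' x) :=
    hN.smooth.continuous.inner hN'.smooth.continuous
  have hself : ∀ x, inner ℝ (N x) (N x) = (1 : ℝ) := by
    intro x
    rw [real_inner_self_eq_norm_sq, hN.norm_eq_one, one_pow]
  rcases hN.eq_or_eq_neg hf hN' q with h | h
  · left
    refine ⟨h, ?_⟩
    have hq : 0 < inner ℝ (N q) (N' q) := by
      rw [h, hself]
      exact one_pos
    have hev : N' =ᶠ[nhds q] N := by
      filter_upwards [hc.continuousAt.eventually_mem (Ioi_mem_nhds hq)] with x hx
      rcases hN.eq_or_eq_neg hf hN' x with h' | h'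
      · exact h'
      · rw [Set.mem_Ioi, h', inner_neg_right, hself] at hx
        norm_num at hx
    exact hev.mfderiv_eq
  · right
    refine ⟨h, ?_⟩
    have hq : inner ℝ (N q) (N' q) < 0 := by
      rw [h, inner_neg_right, hself]
      norm_num
    have hev : N' =ᶠ[nhds q] -N := by
      filter_upwards [hc.continuousAt.eventually_mem (Iio_mem_nhds hq)] with x hx
      rcases hN.eq_or_eq_neg hf hN' x with h' | h'
      · rw [Set.mem_Iio, h', hself] at hx
        norm_num at hx
      · exact h'
    have h1 : diff N' q = diff (-N) q := hev.mfderiv_eq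
    rw [h1]
    exact mfderiv_neg

/-- Under a change of sign of N, U is unchanged and A changes sign, so the principal curvature goes
from c to -c. -/
theorem IsCanonicalPrincipal.of_isUnitNormal {f N N' : M → E3} {k : E3}
    (h : IsCanonicalPrincipal f N k) (hf : IsSmoothImmersion f) (hN : IsUnitNormal f N)
    (hN' : IsUnitNormal f N') : IsCanonicalPrincipal f N' k := by
  intro q
  obtain ⟨hU, c, hc, hA⟩ := h q
  rcases hN.diff_eq_or_eq_neg hf hN' q with ⟨h1, h2⟩ | ⟨h1, h2⟩
  · have e1 : tangentPart f N' k q = tangentPart f N k q := by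
      rw [tangentPart, tangentPart, h1]
    have e2 : shapeOperator f N' q = shapeOperator f N q := by
      rw [shapeOperator, shapeOperator, h2]
    rw [e1, e2]
    exact ⟨hU, c, hc, hA⟩
  · have e1 : tangentPart f N' k q = tangentPart f N k q := by
      rw [tangentPart, tangentPart, h1, inner_neg_right, neg_smul_neg]
    have e2 : ∀ v, shapeOperator f N' q v = -shapeOperator f N q v := by
      intro v
      simp [shapeOperator, h2]
    rw [e1, e2, hA]
    exact ⟨hU, -c, neg_ne_zero.2 hc, by rw [neg_smul]⟩

end Normal

theorem hasFDerivAt_coord (i : Fin 2) (z : E2) :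
    HasFDerivAt (fun z : E2 => z i) (EuclideanSpace.proj i : E2 →L[ℝ] ℝ) z :=
  (EuclideanSpace.proj i : E2 →L[ℝ] ℝ).hasFDerivAt

variable {M : Type*} [TopologicalSpace M] [ChartedSpace E2 M]

/-- A surface with a global parametrization `r` by arc length along plane curves with angle `θ` that
are orthogonal to a horizontal direction is canonical. -/
theorem isCanonicalSurface_of_param {f : M → E3} {k : E3} {e : OpenPartialHomeomorph M E2}
    {θ φ : ℝ → ℝ} {I : Set ℝ} (hk : ‖k‖ = 1) (he : e ∈ IsManifold.maximalAtlas (𝓡 2) ∞ M)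
    (hsrc : e.source = Set.univ) (hdata : IsAngleData I θ φ) (htar : ∀ z ∈ e.target, z 0 ∈ I)
    {F : E3 ≃ᵃⁱ[ℝ] E3} (hFk : F.linearIsometryEquiv k = e3) {r : E2 → E3} {Y ρ : E2 → ℝ}
    (hform : ∀ q ∈ e.source, F (f q) = r (e q)) (hr : ContDiffOn ℝ ∞ r e.target)
    (hY : ContDiff ℝ ∞ Y) (hY0 : ∀ z, fderiv ℝ Y z (EuclideanSpace.single 0 1) = 0)
    (hρ : ∀ z ∈ e.target, ρ z ≠ 0)
    (hdr : ∀ z ∈ e.target, ∀ w, fderiv ℝ r z w =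
      w 0 • !₂[Real.cos (θ (z 0)) * Real.cos (Y z), Real.cos (θ (z 0)) * Real.sin (Y z),
        Real.sin (θ (z 0))] + (w 1 * ρ z) • !₂[-Real.sin (Y z), Real.cos (Y z), 0]) :
    IsCanonicalSurface f k e θ := by
  set L := F.linearIsometryEquiv with hL
  have hmem : ∀ q, q ∈ e.source := fun q => by simp [hsrc]
  have htq : ∀ q, e q ∈ e.target := fun q => e.map_source (hmem q)
  have hF : ∀ x, F x = L x + F 0 := by
    intro x
    have := F.map_vadd 0 x
    simpa using this
  have heM : ContMDiff (𝓡 2) 𝓘(ℝ, E2) ∞ e := by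
    rw [← contMDiffOn_univ, ← hsrc]
    exact contMDiffOn_of_mem_maximalAtlas he
  have hLs : ContDiff ℝ ∞ L.symm := L.symm.toContinuousLinearEquiv.contDiff
  -- functions given in the global chart by `g`, after the isometry
  have hsm : ∀ (g : M → E3) (g' : E2 → E3), ContDiffOn ℝ ∞ g' e.target →
      (∀ q, g q = L.symm (g' (e q))) → ContMDiff (𝓡 2) 𝓘(ℝ, E3) ∞ g := by
    intro g g' hg' hgg'
    have h1 : ContDiffOn ℝ ∞ (fun z => L.symm (g' z)) e.target := hLs.comp_contDiffOn hg'
    rw [← contMDiffOn_univ]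
    exact ((contMDiffOn_iff_contDiffOn.2 h1).comp heM.contMDiffOn fun q _ => htq q).congr
      fun q _ => hgg' q
  have hdiff : ∀ (g : M → E3) (g' : E2 → E3), ContDiffOn ℝ ∞ g' e.target →
      (∀ q, g q = L.symm (g' (e q))) → ∀ q v,
      L (diff g q v) = fderiv ℝ g' (e q) (chartDiff he (hmem q) v) := by
    intro g g' hg' hgg' q v
    have hd : HasFDerivAt g' (fderiv ℝ g' (e q)) (e q) :=
      ((hg'.contDiffAt (e.open_target.mem_nhds (htq q))).differentiableAt (by simp)).hasFDerivAt
    have h1 : HasFDerivAt (fun z => L.symm (g' z))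
        ((L.symm.toContinuousLinearEquiv : E3 →L[ℝ] E3).comp (fderiv ℝ g' (e q))) (e q) :=
      (L.symm.toContinuousLinearEquiv : E3 →L[ℝ] E3).hasFDerivAt.comp (e q) hd
    rw [diff_eq_fderiv_chartDiff he (hmem q) (fun q _ => hgg' q) h1.differentiableAt, h1.fderiv]
    exact L.apply_symm_apply _
  -- Removing the translation part of `F` leaves f = L⁻¹ ∘ r' ∘ e with `L` linear.
  let r' : E2 → E3 := fun z => r z - F 0
  have hr' : ContDiffOn ℝ ∞ r' e.target := hr.sub contDiffOn_const
  have hfr : ∀ q, f q = L.symm (r' (e q)) := by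
    intro q
    simp only [r', ← hform q (hmem q), hF (f q), add_sub_cancel_right, L.symm_apply_apply]
  have hdf : ∀ q v, L (diff f q v) = fderiv ℝ r (e q) (chartDiff he (hmem q) v) := by
    intro q v
    rw [hdiff f r' hr' hfr]
    congr 1
    exact fderiv_sub_const _
  let ϑ : E2 → ℝ := fun z => θ (z 0)
  have hϑ : ContDiffOn ℝ ∞ ϑ e.target :=
    hdata.smooth.comp (EuclideanSpace.proj 0 : E2 →L[ℝ] ℝ).contDiff.contDiffOn htar
  let n : E2 → E3 := fun z => !₂[-(Real.sin (ϑ z) * Real.cos (Y z)),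
    -(Real.sin (ϑ z) * Real.sin (Y z)), Real.cos (ϑ z)]
  have hn : ContDiffOn ℝ ∞ n e.target := by
    refine contDiffOn_euclidean.2 fun i => ?_
    fin_cases i
    · exact (hϑ.sin.mul hY.cos.contDiffOn).neg
    · exact (hϑ.sin.mul hY.sin.contDiffOn).neg
    · exact hϑ.cos
  have hsin : ∀ z ∈ e.target, 0 < Real.sin (ϑ z) := fun z hz =>
    Real.sin_pos_of_pos_of_lt_pi (hdata.mem_Ioo _ (htar z hz)).1 (hdata.mem_Ioo _ (htar z hz)).2
  let N : M → E3 := fun q => L.symm (n (e q))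
  have hnnorm : ∀ z, ‖n z‖ = 1 := by
    intro z
    have h1 : ‖n z‖ ^ 2 = 1 := by
      rw [EuclideanSpace.real_norm_sq_eq, Fin.sum_univ_three]
      simp [n]
      linear_combination Real.sin (ϑ z) ^ 2 * Real.sin_sq_add_cos_sq (Y z) +
        Real.sin_sq_add_cos_sq (ϑ z)
    exact (pow_eq_one_iff_of_nonneg (norm_nonneg _) two_ne_zero).1 h1
  have himm : IsSmoothImmersion f := by
    refine ⟨hsm f r' hr' hfr, fun q => ?_⟩
    refine (injective_iff_map_eq_zero _).2 fun v hv => ?_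
    have h1 := hdf q v
    rw [hv, map_zero, hdr _ (htq q)] at h1
    set w := chartDiff he (hmem q) v with hw
    have hs := hsin _ (htq q)
    have e0 := congrArg (fun x : E3 => x 0) h1
    have e1 := congrArg (fun x : E3 => x 1) h1
    have e2 := congrArg (fun x : E3 => x 2) h1
    simp at e0 e1 e2
    have hw0 : w 0 = 0 := e2.resolve_right hs.ne'
    rw [hw0] at e0 e1
    have hw1 : w 1 * ρ (e q) = 0 := by
      linear_combination Real.sin (Y (e q)) * e0 - Real.cos (Y (e q)) * e1 -
        w 1 * ρ (e q) * Real.sin_sq_add_cos_sq (Y (e q))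
    have hw1 : w 1 = 0 := (mul_eq_zero.1 hw1).resolve_right (hρ _ (htq q))
    have hw00 : w = 0 := by
      ext i
      fin_cases i
      · exact hw0
      · exact hw1
    exact (chartDiff he (hmem q)).injective (hw00.trans (map_zero _).symm)
  have hN : IsUnitNormal f N := by
    refine ⟨hsm N n hn fun q => rfl, fun q => by simp [N, hnnorm], fun q v => ?_⟩
    rw [← L.inner_map_map, hdf, hdr _ (htq q)]
    simp [N, n, ϑ, PiLp.inner_apply, Fin.sum_univ_three]
    linear_combination -(chartDiff he (hmem q) v) 0 * Real.cos (θ (e q 0)) *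
      Real.sin (θ (e q 0)) * Real.sin_sq_add_cos_sq (Y (e q))
  have hkN : ∀ q, inner ℝ k (N q) = Real.cos (ϑ (e q)) := by
    intro q
    rw [← L.inner_map_map, hFk]
    simp [e3, N, n, PiLp.inner_apply, Fin.sum_univ_three]
  refine ⟨himm, ⟨N, hN, fun q hq => ?_⟩, fun N' hN' =>
    IsCanonicalPrincipal.of_isUnitNormal (N := N) (fun q => ?_) himm hN hN'⟩
  · have hm := hdata.mem_Ioo _ (htar _ (htq q))
    rw [InnerProductGeometry.angle, hN.norm_eq_one, hk, real_inner_comm, hkN, mul_one, div_one]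
    exact Real.arccos_cos hm.1.le hm.2.le
  · have hz := htq q
    have hs := hsin _ hz
    set T : E3 := !₂[Real.cos (θ (e q 0)) * Real.cos (Y (e q)),
      Real.cos (θ (e q 0)) * Real.sin (Y (e q)), Real.sin (θ (e q 0))] with hT
    -- The coordinate vector ∂/∂x. Since Y does not depend on x, only θ' survives in the derivative
    -- of the normal along it.
    let v : TangentSpace (𝓡 2) q := (chartDiff he (hmem q)).symm (EuclideanSpace.single 0 1)
    have hv : chartDiff he (hmem q) v = EuclideanSpace.single 0 1 := by simp [v]
    have hfv : L (diff f q v) = T := by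
      rw [hdf, hv, hdr _ hz]
      simp [hT]
    have hNv : L (diff N q v) = -(deriv θ (e q 0) • T) := by
      have hθd : HasDerivAt θ (deriv θ (e q 0)) (e q 0) :=
        ((hdata.smooth.contDiffAt (hdata.interval.1.mem_nhds (htar _ hz))).differentiableAt
          (by simp)).hasDerivAt
      have hϑd : HasFDerivAt ϑ _ (e q) := hθd.comp_hasFDerivAt (e q) (hasFDerivAt_coord 0 (e q))
      rw [hdiff N n hn (fun q => rfl), hv,
        fderiv_polar e.open_target hn hϑ hY.contDiffOn (fun z _ => rfl) hz, hY0, hϑd.fderiv]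
      simp [hT, ϑ]
    have hUv : tangentPart f N k q = Real.sin (ϑ (e q)) • v := by
      refine himm.injective q (L.injective ?_)
      rw [eq_sub_of_add_eq (diff_tangentPart himm hN k q), map_smul, map_smul, hfv, map_sub,
        map_smul, hFk, hkN]
      ext i
      fin_cases i
      · simp [e3, N, n, hT, ϑ]
        ring
      · simp [e3, N, n, hT, ϑ]
        ring
      · simp [e3, N, n, hT, ϑ]
        linear_combination -Real.sin_sq_add_cos_sq (θ (e q 0))
    have hv0 : v ≠ 0 := by
      intro h0
      rw [h0, map_zero] at hv
      have := congrArg (fun w : E2 => w 0) hv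
      simp at this
    have hAv : shapeOperator f N q v = deriv θ (e q 0) • v := by
      refine himm.injective q (L.injective ?_)
      rw [diff_shapeOperator himm hN, map_neg, hNv, neg_neg, map_smul, map_smul, hfv]
    refine ⟨?_, deriv θ (e q 0), hdata.deriv_ne_zero _ (htar _ hz), ?_⟩
    · rw [hUv]
      exact smul_ne_zero hs.ne' hv0
    · rw [hUv, map_smul, hAv, smul_comm]

/-- Here Y = y and ρ = φ + ψ: both φ(x)(cos y, sin y) and γ have y-derivative along (-sin y, cos y).
-/
theorem IsCaseOne.isCanonicalSurface {f : M → E3} {k : E3} {e : OpenPartialHomeomorph M E2}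
    {θ φ ψ : ℝ → ℝ} {I J : Set ℝ} (h : IsCaseOne f k e θ φ ψ I J) (hk : ‖k‖ = 1)
    (hsrc : e.source = Set.univ) : IsCanonicalSurface f k e θ := by
  obtain ⟨F, hFk, hform⟩ := h.formula
  obtain ⟨hI, hI', h0I⟩ := h.angleData.interval
  obtain ⟨hJ, hJ', h0J⟩ := h.interval
  have hS : ∀ x ∈ I, HasDerivAt (fun x => ∫ τ in (0 : ℝ)..x, Real.sin (θ τ))
      (Real.sin (θ x)) x := fun x hx =>
    hasDerivAt_integral_of_continuousOn hI hI' h.angleData.smooth.sin.continuousOn h0I hx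
  have hψs : ContDiffOn ℝ ∞ (fun τ => ψ τ * Real.sin τ) J :=
    h.smooth.mul Real.contDiff_sin.contDiffOn
  have hψc : ContDiffOn ℝ ∞ (fun τ => ψ τ * Real.cos τ) J :=
    h.smooth.mul Real.contDiff_cos.contDiffOn
  have hA : ∀ y ∈ J, HasDerivAt (fun y => ∫ τ in (0 : ℝ)..y, ψ τ * Real.sin τ)
      (ψ y * Real.sin y) y := fun y hy =>
    hasDerivAt_integral_of_continuousOn hJ hJ' hψs.continuousOn h0J hy
  have hB : ∀ y ∈ J, HasDerivAt (fun y => ∫ τ in (0 : ℝ)..y, ψ τ * Real.cos τ)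
      (ψ y * Real.cos y) y := fun y hy =>
    hasDerivAt_integral_of_continuousOn hJ hJ' hψc.continuousOn h0J hy
  have hpr : ∀ i, ContDiff ℝ ∞ (fun z : E2 => z i) := fun i =>
    (EuclideanSpace.proj i : E2 →L[ℝ] ℝ).contDiff
  have hcomp : ∀ (i : Fin 2) (K : Set ℝ) (g : ℝ → ℝ), ContDiffOn ℝ ∞ g K →
      (∀ z ∈ e.target, z i ∈ K) → ContDiffOn ℝ ∞ (fun z : E2 => g (z i)) e.target :=
    fun i K g hg hm => hg.comp (hpr i).contDiffOn hm
  have hx := fun z hz => (h.target z hz).1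
  have hy := fun z hz => (h.target z hz).2
  have hφ := hcomp 0 I φ
    (contDiffOn_of_hasDerivAt hI h.angleData.smooth.cos h.angleData.primitive) hx
  have hr : ContDiffOn ℝ ∞ (fun z : E2 => caseOne θ φ ψ (z 0) (z 1)) e.target := by
    refine contDiffOn_euclidean.2 fun i => ?_
    fin_cases i
    · exact (hφ.mul (hpr 1).cos.contDiffOn).add
        (hcomp 1 J _ (contDiffOn_of_hasDerivAt hJ hψs hA) hy).neg
    · exact (hφ.mul (hpr 1).sin.contDiffOn).add
        (hcomp 1 J _ (contDiffOn_of_hasDerivAt hJ hψc hB) hy)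
    · exact hcomp 0 I _ (contDiffOn_of_hasDerivAt hI h.angleData.smooth.sin hS) hx
  refine isCanonicalSurface_of_param hk h.chart hsrc h.angleData hx hFk
    (r := fun z => caseOne θ φ ψ (z 0) (z 1)) (Y := fun z => z 1)
    (ρ := fun z => φ (z 0) + ψ (z 1)) hform hr (hpr 1) (fun z => ?_) h.regular (fun z hz w => ?_)
  · rw [(hasFDerivAt_coord 1 z).fderiv]
    simp
  · have hd := (hr.contDiffAt (e.open_target.mem_nhds hz)).differentiableAt (by simp)
    have hφd := (h.angleData.primitive _ (hx z hz)).comp_hasFDerivAt z (hasFDerivAt_coord 0 z)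
    have hcd := hasFDerivAt_coord 1 z
    have hAd := (hA _ (hy z hz)).comp_hasFDerivAt z hcd
    have hBd := (hB _ (hy z hz)).comp_hasFDerivAt z hcd
    have hSd := (hS _ (hx z hz)).comp_hasFDerivAt z (hasFDerivAt_coord 0 z)
    ext i
    rw [← fderiv_coord_apply hd]
    fin_cases i
    · have h1 : HasFDerivAt (fun z : E2 => φ (z 0) * Real.cos (z 1) +
          -∫ τ in (0 : ℝ)..z 1, ψ τ * Real.sin τ) _ z := (hφd.mul hcd.cos).add hAd.neg
      refine (congrArg (fun T : E2 →L[ℝ] ℝ => T w) h1.fderiv).trans ?_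
      simp
      ring
    · have h1 : HasFDerivAt (fun z : E2 => φ (z 0) * Real.sin (z 1) +
          ∫ τ in (0 : ℝ)..z 1, ψ τ * Real.cos τ) _ z := (hφd.mul hcd.sin).add hBd
      refine (congrArg (fun T : E2 →L[ℝ] ℝ => T w) h1.fderiv).trans ?_
      simp
      ring
    · have h1 : HasFDerivAt (fun z : E2 => ∫ τ in (0 : ℝ)..z 0, Real.sin (θ τ)) _ z := hSd
      refine (congrArg (fun T : E2 →L[ℝ] ℝ => T w) h1.fderiv).trans ?_
      simp
      ring

theorem IsCaseTwo.isCanonicalSurface {f : M → E3} {k : E3} {e : OpenPartialHomeomorph M E2}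
    {θ φ : ℝ → ℝ} {y₀ : ℝ} {I : Set ℝ} (h : IsCaseTwo f k e θ φ y₀ I) (hk : ‖k‖ = 1)
    (hsrc : e.source = Set.univ) : IsCanonicalSurface f k e θ := by
  obtain ⟨F, hFk, hform⟩ := h.formula
  obtain ⟨hI, hI', h0I⟩ := h.angleData.interval
  have hx := h.target
  have hS : ∀ x ∈ I, HasDerivAt (fun x => ∫ τ in (0 : ℝ)..x, Real.sin (θ τ))
      (Real.sin (θ x)) x := fun x hx =>
    hasDerivAt_integral_of_continuousOn hI hI' h.angleData.smooth.sin.continuousOn h0I hx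
  have hpr : ∀ i, ContDiff ℝ ∞ (fun z : E2 => z i) := fun i =>
    (EuclideanSpace.proj i : E2 →L[ℝ] ℝ).contDiff
  have hφ : ContDiffOn ℝ ∞ (fun z : E2 => φ (z 0)) e.target :=
    (contDiffOn_of_hasDerivAt hI h.angleData.smooth.cos h.angleData.primitive).comp
      (hpr 0).contDiffOn hx
  have hSs : ContDiffOn ℝ ∞ (fun z : E2 => ∫ τ in (0 : ℝ)..z 0, Real.sin (θ τ)) e.target :=
    (contDiffOn_of_hasDerivAt hI h.angleData.smooth.sin hS).comp (hpr 0).contDiffOn hx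
  have hr : ContDiffOn ℝ ∞ (fun z : E2 => caseTwo θ φ y₀ (z 0) (z 1)) e.target := by
    refine contDiffOn_euclidean.2 fun i => ?_
    fin_cases i
    · exact (hφ.mul contDiffOn_const).add ((hpr 1).contDiffOn.mul contDiffOn_const)
    · exact (hφ.mul contDiffOn_const).add ((hpr 1).contDiffOn.mul contDiffOn_const)
    · exact hSs.add ((hpr 1).contDiffOn.mul contDiffOn_const)
  refine isCanonicalSurface_of_param hk h.chart hsrc h.angleData hx hFk
    (r := fun z => caseTwo θ φ y₀ (z 0) (z 1)) (Y := fun _ => y₀)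
    (ρ := fun _ => 1) hform hr contDiff_const (fun z => by simp) (fun _ _ => one_ne_zero)
    (fun z hz w => ?_)
  have hd := (hr.contDiffAt (e.open_target.mem_nhds hz)).differentiableAt (by simp)
  have hφd := (h.angleData.primitive _ (hx z hz)).comp_hasFDerivAt z (hasFDerivAt_coord 0 z)
  have hcd := hasFDerivAt_coord 1 z
  have hSd := (hS _ (hx z hz)).comp_hasFDerivAt z (hasFDerivAt_coord 0 z)
  ext i
  rw [← fderiv_coord_apply hd]
  fin_cases i
  · have h1 : HasFDerivAt (fun z : E2 => φ (z 0) * Real.cos y₀ + z 1 * -Real.sin y₀) _ z :=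
      (hφd.mul_const (Real.cos y₀)).add (hcd.mul_const (-Real.sin y₀))
    refine (congrArg (fun T : E2 →L[ℝ] ℝ => T w) h1.fderiv).trans ?_
    simp
    ring
  · have h1 : HasFDerivAt (fun z : E2 => φ (z 0) * Real.sin y₀ + z 1 * Real.cos y₀) _ z :=
      (hφd.mul_const (Real.sin y₀)).add (hcd.mul_const (Real.cos y₀))
    refine (congrArg (fun T : E2 →L[ℝ] ℝ => T w) h1.fderiv).trans ?_
    simp
    ring
  · have h1 : HasFDerivAt (fun z : E2 => (∫ τ in (0 : ℝ)..z 0, Real.sin (θ τ)) + z 1 * 0) _ z :=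
      hSd.add (hcd.mul_const 0)
    refine (congrArg (fun T : E2 →L[ℝ] ℝ => T w) h1.fderiv).trans ?_
    simp
    ring

end

end CanonicalDirection

end

/-! ### The classification theorem. -/

open CanonicalDirection in
theorem mainTheorem1 {M : Type*} [TopologicalSpace M] [ChartedSpace E2 M]
    [IsManifold (𝓡 2) ∞ M] (k : E3) (hk : ‖k‖ = 1) :
    (∀ f N : M → E3, IsSmoothImmersion f → IsUnitNormal f N → IsCanonicalPrincipal f N k →
      (∀ p, gaussCurvature f N p ≠ 0 → IsCaseOneNear f N k p) ∧
      (∀ p, (∀ᶠ q in nhds p, gaussCurvature f N q = 0) → IsCaseTwoNear f N k p) ∧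
      Dense {p | IsCaseOneNear f N k p ∨ IsCaseTwoNear f N k p}) ∧
    (∀ (f : M → E3) (e : OpenPartialHomeomorph M E2) (θ φ ψ : ℝ → ℝ) (I J : Set ℝ),
      e.source = Set.univ → IsCaseOne f k e θ φ ψ I J → IsCanonicalSurface f k e θ) ∧
    (∀ (f : M → E3) (e : OpenPartialHomeomorph M E2) (θ φ : ℝ → ℝ) (y₀ : ℝ) (I : Set ℝ),
      e.source = Set.univ → IsCaseTwo f k e θ φ y₀ I → IsCanonicalSurface f k e θ) := by
  refine ⟨fun f N hf hN hcan => ?_, fun f e θ φ ψ I J hsrc h => h.isCanonicalSurface hk hsrc,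
    fun f e θ φ y₀ I hsrc h => h.isCanonicalSurface hk hsrc⟩
  have hone : ∀ p, gaussCurvature f N p ≠ 0 → IsCaseOneNear f N k p := fun p hp =>
    isCaseOneNear hk hf hN hcan hp
  have htwo : ∀ p, (∀ᶠ q in nhds p, gaussCurvature f N q = 0) → IsCaseTwoNear f N k p :=
    fun p hp => isCaseTwoNear hk hf hN hcan hp
  refine ⟨hone, htwo, dense_iff_inter_open.2 fun O hO ⟨p, hp⟩ => ?_⟩
  -- Either K is nonzero somewhere in the open set, or it vanishes on all of it, hence near each of
  -- its points.
  by_cases h : ∃ q ∈ O, gaussCurvature f N q ≠ 0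
  · obtain ⟨q, hq, hK⟩ := h
    exact ⟨q, hq, Or.inl (hone q hK)⟩
  · push Not at h
    exact ⟨p, hp, Or.inr (htwo p (Filter.eventually_of_mem (hO.mem_nhds hp) h))⟩
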